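/- Let $d\ge 2$ and write $B'_{d-1}(o,r)=\{(x,0):x\in\mathbb{R}^{d-1},\ \|x\|\le r\}\subset\mathbb{R}^d$. Let $\mathbb{Q}$ be a probability measure on the unit hemisphere $\mathbb{S}^{d-1}_+=\{s\in\mathbb{R}^d:\|s\|=1,\ s_d\ge 0\}$ and suppose that there is a constant $p_S>0$ such that, for every $z\in\{-1,1\}^{d-1}$, $\mathbb{Q}(\overline{\mathcal{S}(z)})>p_S$, where $$\mathcal{S}(z)=\{s\in\mathbb{S}^{d-1}_+:\ \operatorname{sgn}(s_i)=z_i\ (1\le i\le d-1),\ s_d\ge 2/\sqrt5\}.$$ For each $\rho>0$ let $Y^{(1,\rho)},Y^{(2,\rho)},\dots$ be the points of a homogeneous Poisson point process on $\mathbb{R}^{d-1}$ with intensity measure $\rho$ times Lebesgue measure, and let $S^{(1,\rho)},S^{(2,\rho)},\dots$ be independent directions with law $\mathbb{Q}$, independent of the points. Put $X^{(i,\rho)}=\{(Y^{(i,\rho)},0)+tS^{(i,\rho)}:t\ge 0\}$ and, for $K\subset\mathbb{R}^d$, $$\mathcal{X}_\rho(K)=\bigcup_{i:\,Y^{(i,\rho)}\in[0,1]^{d-1}}\bigl(X^{(i,\rho)}\oplus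 K\bigr),\qquad R_\rho(K)=\inf\{r\ge 0:\ \mathcal{X}_\rho(rK)\supset[0,1]^d\},$$ where $\oplus$ is the Minkowski sum and $\inf\emptyset=\infty$. If $K\subset\mathbb{R}^d$ is bounded and contains $B'_{d-1}(o,r)$ for some $r>0$, then there are constants $c_1,c_2>0$, depending only on $d$, $K$ and $\mathbb{Q}$, such that $$\mathbb{P}\Bigl(c_1\le \frac{R_\rho(K)}{(\log\rho/\rho)^{1/(d-1)}}\le c_2\Bigr)\to 1\qquad\text{as }\rho\to\infty .$$ (If $K$ is such that the event is not measurable, this means that the outer probability of its complement tends to $0$.) -/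

import Mathlib

open MeasureTheory ProbabilityTheory Set Filter Topology
open scoped ENNReal NNReal Pointwise

namespace CylinderCoverage

/-- Euclidean space `ℝ^m`. -/
abbrev E (m : ℕ) := EuclideanSpace ℝ (Fin m)

/-- The closed unit cube `[0,1]^m`. -/
def unitCube (m : ℕ) : Set (E m) := {x | ∀ i, x i ∈ Icc (0 : ℝ) 1}

/-- The embedding `y ↦ y × {0}` of `ℝ^n` into `ℝ^(n+1)` (the last coordinate is the height). -/
def embed {n : ℕ} (y : E n) : E (n + 1) :=
  WithLp.toLp 2 (Fin.snoc (α := fun _ => ℝ) (fun i => y i) 0)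

/-- The flat ball `B'_n(o,r) = B_n(o,r) × {0}` in `ℝ^(n+1)`. -/
def flatBall (n : ℕ) (r : ℝ) : Set (E (n + 1)) := embed '' Metric.closedBall (0 : E n) r

/-- The unit hemisphere of directions with nonnegative last coordinate in `ℝ^(n+1)`. -/
def hemisphere (n : ℕ) : Set (E (n + 1)) := {s | ‖s‖ = 1 ∧ 0 ≤ s (Fin.last n)}

/-- The near-vertical directions whose first `n` coordinates have the prescribed signs `z`. -/
def signedDirections {n : ℕ} (z : Fin n → SignType) : Set (E (n + 1)) :=
  {s | s ∈ hemisphere n ∧ (∀ i : Fin n, SignType.sign (s i.castSucc) = z i) ∧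
    2 / √5 ≤ s (Fin.last n)}

/-- The condition on the direction law: for every choice of signs in `{-1,1}^n`, the closure of
the corresponding set of near-vertical directions has probability larger than a common
positive constant. -/
def DirectionCondition {n : ℕ} (Q : Measure (E (n + 1))) : Prop :=
  ∃ p : ℝ, 0 < p ∧ ∀ z : Fin n → SignType, (∀ i, z i = 1 ∨ z i = -1) →
    ENNReal.ofReal p < Q (closure (signedDirections z))

/-- The trajectory `{(y,0) + t s : t ≥ 0}` of the point `y` of the base moving in direction `s`. -/
def trajectory {n : ℕ} (y : E n) (s : E (n + 1)) : Set (E (n + 1)) :=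
  {x | ∃ t : ℝ, 0 ≤ t ∧ x = embed y + t • s}

/-- The cylinder set generated by starting points `y`, directions `s` and a set `K`: the union of
the Minkowski sums of `K` with the trajectories of those points that start in `[0,1]^n`. -/
def cylinderSet {n : ℕ} (y : ℕ → E n) (s : ℕ → E (n + 1)) (K : Set (E (n + 1))) :
    Set (E (n + 1)) :=
  ⋃ i ∈ {i : ℕ | y i ∈ unitCube n}, (trajectory (y i) (s i) + K)

/-- The coverage radius: the infimum of the `r ≥ 0` for which the cylinder set generated by `r K`
covers `[0,1]^(n+1)`; it is `∞` if there is no such `r`. -/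
noncomputable def coverageRadius {n : ℕ} (y : ℕ → E n) (s : ℕ → E (n + 1))
    (K : Set (E (n + 1))) : ℝ≥0∞ :=
  sInf {R | ∃ r : ℝ≥0, unitCube (n + 1) ⊆ cylinderSet y s ((r : ℝ) • K) ∧ R = (r : ℝ≥0∞)}

/-- The point measure `∑ i, δ_{y i}`. -/
noncomputable def pointMeasure {X : Type*} [MeasurableSpace X] (y : ℕ → X) : Measure X :=
  Measure.sum fun i => Measure.dirac (y i)

/-- The random points `Y 0, Y 1, …` form a Poisson point process with intensity measure `ν`: the
number of points in a set `B` of finite intensity is Poisson distributed with mean `ν B`, and the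
numbers of points in disjoint sets are independent. -/
structure IsPoissonProcess {Ω X : Type*} [MeasurableSpace Ω] [MeasurableSpace X]
    (μ : Measure Ω) (ν : Measure X) (Y : ℕ → Ω → X) : Prop where
  measurable : ∀ i, Measurable (Y i)
  poisson : ∀ B : Set X, MeasurableSet B → ν B ≠ ∞ → ∀ k : ℕ,
    μ {ω | pointMeasure (fun i => Y i ω) B = k} = poissonMeasure (ν B).toNNReal {k}
  indep : ∀ (m : ℕ) (B : Fin m → Set X), (∀ j, MeasurableSet (B j)) →
    Pairwise (fun j k => Disjoint (B j) (B k)) →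
    iIndepFun (fun j ω => pointMeasure (fun i => Y i ω) (B j)) μ

/-- The random input of the cylinder model of intensity `ρ`: a homogeneous Poisson process of
starting points on `ℝ^n` with intensity `ρ` times Lebesgue measure, and independent directions
with common law `Q`, independent of the starting points. -/
structure IsLineModel {Ω : Type*} [MeasurableSpace Ω] (μ : Measure Ω) {n : ℕ}
    (Q : Measure (E (n + 1))) (ρ : ℝ) (Y : ℕ → Ω → E n) (S : ℕ → Ω → E (n + 1)) : Prop where
  points : IsPoissonProcess μ (ENNReal.ofReal ρ • (volume : Measure (E n))) Y
  measurable_dir : ∀ i, Measurable (S i)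
  law_dir : ∀ i, μ.map (S i) = Q
  indep_dir : iIndepFun S μ
  indep_points_dir : IndepFun (fun ω i => Y i ω) (fun ω i => S i ω) μ

end CylinderCoverage

namespace CylinderCoverage

/-! ### Generating functionals and void probabilities of marked Poisson processes -/

section PointProcess

variable {Ω X Z : Type*} [MeasurableSpace Ω] [MeasurableSpace X] [MeasurableSpace Z]

/-! Write n = d - 1 and call (log ρ/ρ)^(1/n) the scale. Everything rests on void probabilities: the
pairs (start, direction) miss a set A of finite intensity with probability exp(-(ν ⊗ Q)(A)). Given
the points, independent marks miss A with probability ∏ (1 - Q(A_y)), and the generating functional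
of the Poisson process turns this into the exponential (`IsPoissonProcess.measure_forall_notMem`).
Since measures of disjoint sets add, hitting events of disjoint sets are independent
(`IsPoissonProcess.measure_forall_exists_mem`).

Lower bound. If rK covers the cube, it covers points u of the upper face, and any trajectory that
does so starts within a constant times r of u minus its slope (`norm_sub_slope_le_of_hit`). These
starts and directions have intensity of order ρ r^n, whatever Q is. About ρ^(1/(2n)) test points on
the diagonal give disjoint sets. With r a small multiple of the scale, each is missed with
probability at least ρ^(-1/(4n)), so some test point is uncovered with probability tending to 1.

Upper bound. Every point of the cube can be traced backwards along any direction of a suitable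
closed sector without leaving the cube (`sub_slope_mem_unitCube`). The sector has probability at
least p, so a grid point has no suitable trajectory with probability at most exp(-ρ ε^n p), where ε
is proportional to r. For r a large multiple of the scale this beats the polynomial number of grid
points, and the flat ball in K carries coverage from the grid to the whole cube
(`coverageRadius_le_of_grid`). -/

lemma tsum_poissonMeasure_mul_pow (r : ℝ≥0) {x : ℝ≥0∞} (hx : x ≤ 1) :
    ∑' k : ℕ, x ^ k * poissonMeasure r {k} =
      ENNReal.ofReal (Real.exp (-(r * (1 - x.toReal)))) := by
  have hxt : x ≠ ∞ := ne_top_of_le_ne_top ENNReal.one_ne_top hx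
  have h1 : ∀ k : ℕ, x ^ k * poissonMeasure r {k} =
      ENNReal.ofReal (Real.exp (-r) * ((r * x.toReal) ^ k / k.factorial)) := by
    intro k
    rw [poissonMeasure_singleton]
    conv_lhs => rw [← ENNReal.ofReal_toReal hxt]
    rw [← ENNReal.ofReal_pow ENNReal.toReal_nonneg,
      ← ENNReal.ofReal_mul (pow_nonneg ENNReal.toReal_nonneg _)]
    congr 1
    ring
  have h2 : HasSum (fun k : ℕ => Real.exp (-r) * ((r * x.toReal) ^ k / k.factorial))
      (Real.exp (-(r * (1 - x.toReal)))) := by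
    convert! (NormedSpace.expSeries_div_hasSum_exp ((r : ℝ) * x.toReal)).mul_left
      (Real.exp (-r)) using 1
    rw [← Real.exp_eq_exp_ℝ, ← Real.exp_add]
    congr 1
    ring
  simp_rw [h1]
  rw [← ENNReal.ofReal_tsum_of_nonneg (fun k => by positivity) h2.summable, h2.tsum_eq]

lemma ae_exists_natCast_of_poisson {μ : Measure Ω} [IsProbabilityMeasure μ] {N : Ω → ℝ≥0∞}
    (hN : Measurable N) {r : ℝ≥0} (h : ∀ k : ℕ, μ {ω | N ω = k} = poissonMeasure r {k}) :
    ∀ᵐ ω ∂μ, ∃ k : ℕ, N ω = k := by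
  have hm : ∀ k : ℕ, MeasurableSet {ω | N ω = k} := fun k => hN (measurableSet_singleton _)
  have h1 : μ (⋃ k : ℕ, {ω | N ω = k}) = 1 := by
    rw [measure_iUnion _ hm]
    · simp_rw [h]
      -- The generating function at 1 is the total mass of the law.
      have := tsum_poissonMeasure_mul_pow r (x := 1) le_rfl
      simpa using this
    · intro i j hij
      refine Set.disjoint_left.2 fun ω hi hj => hij ?_
      simp only [mem_ofPred_eq] at hi hj
      exact_mod_cast hi.symm.trans hj
  have h2 := (prob_compl_eq_zero_iff (MeasurableSet.iUnion hm)).2 h1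
  rw [ae_iff]
  convert h2 using 2
  ext ω
  simp

lemma lintegral_comp_of_poisson {μ : Measure Ω} [IsProbabilityMeasure μ] {N : Ω → ℝ≥0∞}
    (hN : Measurable N) {r : ℝ≥0} (h : ∀ k : ℕ, μ {ω | N ω = k} = poissonMeasure r {k})
    (φ : ℝ≥0∞ → ℝ≥0∞) :
    ∫⁻ ω, φ (N ω) ∂μ = ∑' k : ℕ, φ k * poissonMeasure r {k} := by
  have hm : ∀ k : ℕ, MeasurableSet {ω | N ω = k} := fun k => hN (measurableSet_singleton _)
  have h1 : ∫⁻ ω, φ (N ω) ∂μ = ∫⁻ ω in ⋃ k : ℕ, {ω | N ω = k}, φ (N ω) ∂μ := by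
    rw [setLIntegral_congr (t := univ), setLIntegral_univ]
    refine eventuallyEq_univ.2 ?_
    filter_upwards [ae_exists_natCast_of_poisson hN h] with ω hω
    simpa using hω
  rw [h1, lintegral_iUnion hm]
  · refine tsum_congr fun k => ?_
    rw [setLIntegral_congr_fun (g := fun _ => φ k) (hm k) (fun ω hω => by
      simp only [mem_ofPred_eq] at hω; simp [hω]), setLIntegral_const, h]
  · intro i j hij
    refine Set.disjoint_left.2 fun ω hi hj => hij ?_
    simp only [mem_ofPred_eq] at hi hj
    exact_mod_cast hi.symm.trans hj

lemma pointMeasure_apply (y : ℕ → X) {B : Set X} (hB : MeasurableSet B) :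
    pointMeasure y B = ∑' i, B.indicator 1 (y i) := by
  rw [pointMeasure, Measure.sum_apply _ hB]
  simp_rw [Measure.dirac_apply' _ hB]

lemma pointMeasure_eq_encard (y : ℕ → X) {B : Set X} (hB : MeasurableSet B) :
    pointMeasure y B = ({i | y i ∈ B} : Set ℕ).encard := by
  rw [pointMeasure_apply y hB, ← ENNReal.tsum_set_one,
    tsum_subtype {i | y i ∈ B} (fun _ => (1 : ℝ≥0∞))]
  exact tsum_congr fun i => rfl

lemma measurable_pointMeasure {Y : ℕ → Ω → X} (hY : ∀ i, Measurable (Y i)) {B : Set X}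
    (hB : MeasurableSet B) : Measurable fun ω => pointMeasure (fun i => Y i ω) B := by
  simp_rw [pointMeasure_apply _ hB]
  exact Measurable.tsum fun i => (measurable_one.indicator hB).comp (hY i)

/-- The multiplicative functional `∏ i, g (y i)` of the points, for `g ≤ 1`. -/
noncomputable def pointProd (g : X → ℝ≥0∞) (y : ℕ → X) : ℝ≥0∞ :=
  ⨅ N : ℕ, ∏ i ∈ Finset.range N, g (y i)

lemma antitone_prod_range {a : ℕ → ℝ≥0∞} (ha : ∀ i, a i ≤ 1) :
    Antitone fun N : ℕ => ∏ i ∈ Finset.range N, a i :=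
  antitone_nat_of_succ_le fun N => by
    rw [Finset.prod_range_succ]
    exact mul_le_of_le_one_right' (ha N)

/-- Only finitely many factors differ from 1, so the partial products stabilise; grouping the
factors by the value of `h` gives the powers. -/
lemma pointProd_simple (h : SimpleFunc X ℝ≥0∞) (y : ℕ → X)
    (hfin : ∀ c ∈ h.range.erase 0, ({i | h (y i) = c} : Set ℕ).Finite) :
    pointProd (fun x => 1 - h x) y =
      ∏ c ∈ h.range.erase 0, (1 - c) ^ ({i | h (y i) = c} : Set ℕ).ncard := by
  have hF : ({i | h (y i) ≠ 0} : Set ℕ).Finite := by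
    refine (Set.Finite.biUnion (Finset.finite_toSet _) hfin).subset fun i hi => ?_
    simp only [mem_ofPred_eq] at hi
    simp only [mem_iUnion]
    exact ⟨h (y i), by simp [hi], rfl⟩
  have hprod : ∏ i ∈ hF.toFinset, (1 - h (y i)) =
      ∏ c ∈ h.range.erase 0, (1 - c) ^ ({i | h (y i) = c} : Set ℕ).ncard := by
    rw [← Finset.prod_fiberwise_of_maps_to (t := h.range.erase 0) (g := fun i => h (y i))]
    · refine Finset.prod_congr rfl fun c hc => ?_
      rw [Finset.prod_congr rfl (g := fun _ => 1 - c), Finset.prod_const]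
      · congr 1
        rw [← Set.ncard_coe_finset]
        congr 1
        ext i
        simp only [Finset.mem_erase] at hc
        simp only [ne_eq, Finset.coe_filter, Finite.mem_toFinset, mem_ofPred_eq,
          and_iff_right_iff_imp]
        rintro rfl
        exact hc.1
      · intro i hi
        rw [(Finset.mem_filter.1 hi).2]
    · intro i hi
      simpa using hi
  have hlarge : ∀ N, hF.toFinset ⊆ Finset.range N →
      ∏ i ∈ Finset.range N, (1 - h (y i)) = ∏ i ∈ hF.toFinset, (1 - h (y i)) := by
    intro N hN
    refine (Finset.prod_subset hN fun i _ hi => ?_).symm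
    have : h (y i) = 0 := by simpa using hi
    simp [this]
  obtain ⟨N₀, hN₀⟩ := hF.toFinset.exists_nat_subset_range
  rw [← hprod]
  refine le_antisymm ?_ (le_iInf fun N => ?_)
  · rw [← hlarge N₀ hN₀]
    exact iInf_le _ N₀
  · rw [← hlarge (max N N₀) (hN₀.trans (Finset.range_mono (le_max_right _ _)))]
    exact antitone_prod_range (a := fun i => 1 - h (y i)) (fun i => tsub_le_self)
      (le_max_left _ _)

/-- The level sets of the nonzero values are disjoint and of finite intensity, so their counts are
independent Poisson variables and the expectation factors into values of Poisson generating
functions. -/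
lemma IsPoissonProcess.lintegral_pointProd_simple {μ : Measure Ω} [IsProbabilityMeasure μ]
    {ν : Measure X} {Y : ℕ → Ω → X} (hY : IsPoissonProcess μ ν Y) (h : SimpleFunc X ℝ≥0∞)
    (h1 : ∀ x, h x ≤ 1) (hν : ν (Function.support h) < ∞) :
    ∫⁻ ω, pointProd (fun x => 1 - h x) (fun i => Y i ω) ∂μ =
      ENNReal.ofReal (Real.exp (-(∫⁻ x, h x ∂ν).toReal)) := by
  set T := h.range.erase 0 with hT
  have hc0 : ∀ c ∈ T, c ≠ 0 := fun c hc => (Finset.mem_erase.1 hc).1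
  have hc1 : ∀ c ∈ T, c ≤ 1 := fun c hc => by
    obtain ⟨x, rfl⟩ := SimpleFunc.mem_range.1 (Finset.mem_erase.1 hc).2
    exact h1 x
  have hBm : ∀ c, MeasurableSet (h ⁻¹' {c}) := fun c => h.measurableSet_preimage _
  have hBν : ∀ c ∈ T, ν (h ⁻¹' {c}) ≠ ∞ := fun c hc => by
    refine (lt_of_le_of_lt (measure_mono fun x hx => ?_) hν).ne
    have : h x = c := hx
    simpa [this] using hc0 c hc
  set N : ℝ≥0∞ → Ω → ℝ≥0∞ := fun c ω => pointMeasure (fun i => Y i ω) (h ⁻¹' {c}) with hN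
  have hNm : ∀ c, Measurable (N c) := fun c => measurable_pointMeasure hY.measurable (hBm c)
  have hNP : ∀ c ∈ T, ∀ k : ℕ, μ {ω | N c ω = k} = poissonMeasure (ν (h ⁻¹' {c})).toNNReal {k} :=
    fun c hc => hY.poisson _ (hBm c) (hBν c hc)
  have hae : ∀ᵐ ω ∂μ, ∀ c ∈ T, ∃ k : ℕ, N c ω = k :=
    (Finset.eventually_all T).2 fun c hc => ae_exists_natCast_of_poisson (hNm c) (hNP c hc)
  have hlhs : ∫⁻ ω, pointProd (fun x => 1 - h x) (fun i => Y i ω) ∂μ =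
      ∫⁻ ω, ∏ j : Fin T.card,
        -- Using `toReal` in the exponent makes each factor a measurable function of an extended
        -- count; infinite counts occur only on a null set.
        (fun x : ℝ≥0∞ => (1 - ((T.equivFin.symm j : T) : ℝ≥0∞)) ^ x.toReal)
          (N (T.equivFin.symm j : T) ω) ∂μ := by
    refine lintegral_congr_ae ?_
    filter_upwards [hae] with ω hω
    have hcard : ∀ c ∈ T, ({i | h (Y i ω) = c} : Set ℕ).Finite ∧
        N c ω = ({i | h (Y i ω) = c} : Set ℕ).ncard := by
      intro c hc
      obtain ⟨k, hk⟩ := hω c hc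
      have hk' : N c ω = (({i | h (Y i ω) = c} : Set ℕ).encard : ℝ≥0∞) :=
        pointMeasure_eq_encard _ (hBm c)
      have hf : ({i | h (Y i ω) = c} : Set ℕ).Finite := by
        rw [← Set.encard_ne_top_iff]
        intro htop
        rw [htop, hk] at hk'
        simp at hk'
      refine ⟨hf, ?_⟩
      rw [hk', ← hf.cast_ncard_eq]
      rfl
    rw [pointProd_simple h _ fun c hc => (hcard c hc).1, ← hT,
      Equiv.prod_comp T.equivFin.symm
        (fun c : T => (1 - (c : ℝ≥0∞)) ^ (N c ω).toReal), ← Finset.prod_coe_sort]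
    refine Finset.prod_congr rfl fun c _ => ?_
    rw [(hcard c c.2).2, ENNReal.toReal_natCast, ENNReal.rpow_natCast]
  have hindep := hY.indep T.card (fun j => h ⁻¹' {((T.equivFin.symm j : T) : ℝ≥0∞)})
    (fun j => hBm _) (by
      intro j k hjk
      refine Set.disjoint_left.2 fun x hx hx' => hjk ?_
      have : ((T.equivFin.symm j : T) : ℝ≥0∞) = (T.equivFin.symm k : T) := hx.symm.trans hx'
      exact T.equivFin.symm.injective (Subtype.ext this))
  have hφ : ∀ c : ℝ≥0∞, Measurable fun x : ℝ≥0∞ => (1 - c) ^ x.toReal := fun c => by fun_prop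
  have hind2 := hindep.comp (fun j (x : ℝ≥0∞) =>
    (1 - ((T.equivFin.symm j : T) : ℝ≥0∞)) ^ x.toReal) (fun j => hφ _)
  rw [hlhs]
  rw [lintegral_prod_eq_prod_lintegral_of_indepFun Finset.univ
    (fun j ω => (fun x : ℝ≥0∞ => (1 - ((T.equivFin.symm j : T) : ℝ≥0∞)) ^ x.toReal)
          (N (T.equivFin.symm j : T) ω)) hind2 (fun j => (hφ _).comp (hNm _))]
  rw [Equiv.prod_comp T.equivFin.symm
    (fun c : T => ∫⁻ ω, (fun x : ℝ≥0∞ => (1 - (c : ℝ≥0∞)) ^ x.toReal) (N c ω) ∂μ)]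
  have hint : (∫⁻ x, h x ∂ν).toReal = ∑ c : T, (ν (h ⁻¹' {(c : ℝ≥0∞)})).toReal * (c : ℝ≥0∞).toReal := by
    rw [SimpleFunc.lintegral_eq_lintegral, SimpleFunc.lintegral,
      ← Finset.sum_erase (a := 0) _ (by simp), ← hT, ENNReal.toReal_sum, ← Finset.sum_coe_sort T]
    · exact Finset.sum_congr rfl fun c _ => by rw [ENNReal.toReal_mul, mul_comm]
    · exact fun c hc => ENNReal.mul_ne_top (ne_top_of_le_ne_top ENNReal.one_ne_top (hc1 c hc))
        (hBν c hc)
  rw [hint, ← Finset.sum_neg_distrib, Real.exp_sum, ENNReal.ofReal_prod_of_nonneg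
    (fun _ _ => (Real.exp_pos _).le)]
  refine Finset.prod_congr rfl fun c _ => ?_
  rw [lintegral_comp_of_poisson (hNm c) (hNP c c.2) (fun x => (1 - (c : ℝ≥0∞)) ^ x.toReal)]
  simp_rw [ENNReal.toReal_natCast, ENNReal.rpow_natCast]
  rw [tsum_poissonMeasure_mul_pow _ tsub_le_self,
    ENNReal.toReal_sub_of_le (hc1 c c.2) ENNReal.one_ne_top]
  congr 3
  simp [ENNReal.coe_toNNReal_eq_toReal]

lemma measurable_pointProd {Y : ℕ → Ω → X} (hY : ∀ i, Measurable (Y i)) {g : X → ℝ≥0∞}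
    (hg : Measurable g) : Measurable fun ω => pointProd g (fun i => Y i ω) :=
  Measurable.iInf fun _ => Finset.measurable_prod _ fun i _ => hg.comp (hY i)

/-- The probability generating functional of a Poisson process. -/
theorem IsPoissonProcess.lintegral_pointProd {μ : Measure Ω} [IsProbabilityMeasure μ]
    {ν : Measure X} {Y : ℕ → Ω → X} (hY : IsPoissonProcess μ ν Y) {f : X → ℝ≥0∞}
    (hf : Measurable f) (h1 : ∀ x, f x ≤ 1) (hν : ∫⁻ x, f x ∂ν ≠ ∞) :
    ∫⁻ ω, pointProd (fun x => 1 - f x) (fun i => Y i ω) ∂μ =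
      ENNReal.ofReal (Real.exp (-(∫⁻ x, f x ∂ν).toReal)) := by
  have hle : ∀ m x, SimpleFunc.eapprox f m x ≤ f x := fun m x => by
    rw [← SimpleFunc.iSup_eapprox_apply hf x]
    exact le_iSup (fun m => SimpleFunc.eapprox f m x) m
  have hanti : ∀ (N : ℕ) (y : ℕ → X), Antitone fun m : ℕ =>
      ∏ i ∈ Finset.range N, (1 - SimpleFunc.eapprox f m (y i)) := fun N y m m' hmm =>
    Finset.prod_le_prod' fun i _ => tsub_le_tsub_left (SimpleFunc.monotone_eapprox f hmm _) _
  -- Approximating `f` from below makes the products decrease in `m` as well as in `N`, so the two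
  -- infima commute; monotone convergence then applies.
  have hlim : ∀ y : ℕ → X, pointProd (fun x => 1 - f x) y =
      ⨅ m, pointProd (fun x => 1 - SimpleFunc.eapprox f m x) y := by
    intro y
    simp only [pointProd]
    rw [iInf_comm]
    refine iInf_congr fun N => ?_
    refine tendsto_nhds_unique ?_ (tendsto_atTop_iInf (hanti N y))
    refine ENNReal.tendsto_finsetProd_of_ne_top _ (fun i _ => ?_) (fun i _ => ?_)
    · exact ENNReal.Tendsto.sub tendsto_const_nhds (SimpleFunc.tendsto_eapprox hf _)
        (Or.inl ENNReal.one_ne_top)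
    · exact ne_top_of_le_ne_top ENNReal.one_ne_top tsub_le_self
  have hantiP : Antitone fun m ω =>
      pointProd (fun x => 1 - SimpleFunc.eapprox f m x) (fun i => Y i ω) :=
    fun m m' hmm ω => iInf_mono fun N => hanti N (fun i => Y i ω) hmm
  have hmeasP : ∀ m, Measurable fun ω =>
      pointProd (fun x => 1 - SimpleFunc.eapprox f m x) (fun i => Y i ω) := fun m =>
    measurable_pointProd hY.measurable
      (Measurable.sub measurable_const (SimpleFunc.measurable (SimpleFunc.eapprox f m)))
  rw [lintegral_congr fun ω => hlim fun i => Y i ω]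
  rw [lintegral_iInf (f := fun m ω =>
      pointProd (fun x => 1 - SimpleFunc.eapprox f m x) (fun i => Y i ω)) hmeasP hantiP]
  · have hs : ∀ m, ∫⁻ ω, pointProd (fun x => 1 - SimpleFunc.eapprox f m x) (fun i => Y i ω) ∂μ =
        ENNReal.ofReal (Real.exp (-(∫⁻ x, SimpleFunc.eapprox f m x ∂ν).toReal)) := fun m =>
      hY.lintegral_pointProd_simple _ (fun x => (hle m x).trans (h1 x))
        (measure_support_eapprox_lt_top hf hν m)
    have ht1 := tendsto_atTop_iInf (f := fun m => ∫⁻ ω, pointProd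
      (fun x => 1 - SimpleFunc.eapprox f m x) (fun i => Y i ω) ∂μ)
      (fun m m' hmm => lintegral_mono (hantiP hmm))
    refine tendsto_nhds_unique ht1 ?_
    simp_rw [hs]
    have ht2 : Tendsto (fun m => ∫⁻ x, SimpleFunc.eapprox f m x ∂ν) atTop
        (𝓝 (∫⁻ x, f x ∂ν)) :=
      lintegral_tendsto_of_tendsto_of_monotone (fun m => (SimpleFunc.measurable _).aemeasurable)
        (ae_of_all _ fun x m m' hmm => SimpleFunc.monotone_eapprox f hmm x)
        (ae_of_all _ fun x => SimpleFunc.tendsto_eapprox hf x)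
    have ht3 : Tendsto (fun m => (∫⁻ x, SimpleFunc.eapprox f m x ∂ν).toReal) atTop
        (𝓝 (∫⁻ x, f x ∂ν).toReal) := (ENNReal.tendsto_toReal hν).comp ht2
    exact ENNReal.tendsto_ofReal (Tendsto.rexp ht3.neg)
  · refine ne_top_of_le_ne_top ENNReal.one_ne_top ?_
    calc _ ≤ ∫⁻ _, 1 ∂μ := lintegral_mono fun ω => by
            simp only [pointProd]
            exact (iInf_le _ 0).trans (by simp)
      _ = 1 := by simp

/-- The void probabilities of an independently marked Poisson process. -/
theorem IsPoissonProcess.measure_forall_notMem {μ : Measure Ω} [IsProbabilityMeasure μ]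
    {ν : Measure X} [SFinite ν] {Q : Measure Z} [IsProbabilityMeasure Q] {Y : ℕ → Ω → X}
    {S : ℕ → Ω → Z} (hY : IsPoissonProcess μ ν Y) (hS : ∀ i, Measurable (S i))
    (hlaw : ∀ i, μ.map (S i) = Q) (hind : iIndepFun S μ)
    (hYS : IndepFun (fun ω i => Y i ω) (fun ω i => S i ω) μ) {A : Set (X × Z)}
    (hA : MeasurableSet A) (hfin : ν.prod Q A ≠ ∞) :
    μ {ω | ∀ i, (Y i ω, S i ω) ∉ A} = ENNReal.ofReal (Real.exp (-(ν.prod Q A).toReal)) := by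
  have hf : Measurable fun x => Q (Prod.mk x ⁻¹' A) := measurable_measure_prodMk_left hA
  have hYm : Measurable fun ω i => Y i ω := measurable_pi_lambda _ hY.measurable
  have hSm : Measurable fun ω i => S i ω := measurable_pi_lambda _ hS
  -- Conditioning on the points: the joint law of points and marks is a product, and for fixed
  -- points the independent marks avoid the slices of `A` independently.
  have hstep : ∀ N : ℕ, μ {ω | ∀ i ∈ Finset.range N, (Y i ω, S i ω) ∉ A} =
      ∫⁻ ω, ∏ i ∈ Finset.range N, (1 - Q (Prod.mk (Y i ω) ⁻¹' A)) ∂μ := by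
    intro N
    let D : Set ((ℕ → X) × (ℕ → Z)) := {p | ∀ i ∈ Finset.range N, (p.1 i, p.2 i) ∉ A}
    have hD : MeasurableSet D := by
      have : D = ⋂ i ∈ Finset.range N,
          (fun p : (ℕ → X) × (ℕ → Z) => (p.1 i, p.2 i)) ⁻¹' Aᶜ := by
        ext p
        simp [D]
      rw [this]
      exact Finset.measurableSet_biInter _ fun i _ =>
        (((measurable_pi_apply i).comp measurable_fst).prodMk
          ((measurable_pi_apply i).comp measurable_snd)) hA.compl
    have h1 : μ {ω | ∀ i ∈ Finset.range N, (Y i ω, S i ω) ∉ A} =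
        μ.map (fun ω => (fun i => Y i ω, fun i => S i ω)) D :=
      (Measure.map_apply (hYm.prodMk hSm) hD).symm
    have : IsProbabilityMeasure (μ.map fun ω i => S i ω) :=
      Measure.isProbabilityMeasure_map hSm.aemeasurable
    rw [h1, (indepFun_iff_map_prod_eq_prod_map_map hYm.aemeasurable hSm.aemeasurable).1 hYS,
      Measure.prod_apply hD, lintegral_map (measurable_measure_prodMk_left hD) hYm]
    refine lintegral_congr fun ω => ?_
    rw [Measure.map_apply hSm (measurable_prodMk_left hD)]
    have h2 : (fun ω' i => S i ω') ⁻¹' (Prod.mk (fun i => Y i ω) ⁻¹' D) =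
        ⋂ i ∈ Finset.range N, S i ⁻¹' (Prod.mk (Y i ω) ⁻¹' A)ᶜ := by
      ext ω'
      simp [D]
    rw [h2, hind.measure_inter_preimage_eq_mul _
      (fun i _ => (measurable_prodMk_left hA).compl)]
    refine Finset.prod_congr rfl fun i _ => ?_
    rw [← Measure.map_apply (hS i) (measurable_prodMk_left hA).compl, hlaw,
      prob_compl_eq_one_sub (measurable_prodMk_left hA)]
  have hmono : Antitone fun N : ℕ => {ω | ∀ i ∈ Finset.range N, (Y i ω, S i ω) ∉ A} :=
    fun N M hNM ω hω i hi => hω i (Finset.range_mono hNM hi)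
  have hinter : {ω | ∀ i, (Y i ω, S i ω) ∉ A} =
      ⋂ N : ℕ, {ω | ∀ i ∈ Finset.range N, (Y i ω, S i ω) ∉ A} := by
    ext ω
    simp only [mem_ofPred_eq, mem_iInter, Finset.mem_range]
    exact ⟨fun h N i _ => h i, fun h i => h (i + 1) i (Nat.lt_succ_self i)⟩
  have hmeas : ∀ N : ℕ, MeasurableSet {ω | ∀ i ∈ Finset.range N, (Y i ω, S i ω) ∉ A} := by
    intro N
    have : {ω | ∀ i ∈ Finset.range N, (Y i ω, S i ω) ∉ A} = ⋂ i ∈ Finset.range N,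
        (fun ω => (Y i ω, S i ω)) ⁻¹' Aᶜ := by
      ext ω
      simp
    rw [this]
    exact Finset.measurableSet_biInter _ fun i _ => ((hY.measurable i).prodMk (hS i)) hA.compl
  rw [hinter, hmono.measure_iInter (fun N => (hmeas N).nullMeasurableSet)
    ⟨0, measure_ne_top _ _⟩]
  simp_rw [hstep]
  rw [Measure.prod_apply hA] at hfin ⊢
  -- The generating functional is applied to `f x = Q (A_x)`, whose `ν`-integral is the product
  -- measure of `A`.
  rw [← hY.lintegral_pointProd hf (fun x => prob_le_one) hfin]
  simp only [pointProd]
  rw [lintegral_iInf (f := fun (N : ℕ) ω => ∏ i ∈ Finset.range N, (1 - Q (Prod.mk (Y i ω) ⁻¹' A)))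
    (fun N => Finset.measurable_prod _ fun i _ =>
      (measurable_const.sub hf).comp (hY.measurable i))]
  · exact fun N M hNM ω => antitone_prod_range (a := fun i => 1 - Q (Prod.mk (Y i ω) ⁻¹' A))
      (fun i => tsub_le_self) hNM
  · simp

end PointProcess

/-- The product formula over all finite subfamilies is independence of the events, which passes to
the generated σ-algebras and hence to complements. -/
lemma measure_iInter_compl_of_measure_biInter {Ω ι : Type*} [MeasurableSpace Ω] [Fintype ι]
    {μ : Measure Ω} [IsProbabilityMeasure μ] {V : ι → Set Ω} (hV : ∀ j, MeasurableSet (V j))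
    (h : ∀ s : Finset ι, μ (⋂ j ∈ s, V j) = ∏ j ∈ s, μ (V j)) :
    μ (⋂ j, (V j)ᶜ) = ∏ j, (1 - μ (V j)) := by
  have hi := (iIndepSet_iff_meas_biInter hV).2 h
  have := (iIndepSet_iff V μ).1 hi Finset.univ (f := fun j => (V j)ᶜ)
    (fun j _ => (MeasurableSpace.measurableSet_generateFrom (mem_singleton _)).compl)
  simp only [Finset.mem_univ, iInter_true] at this
  rw [this]
  exact Finset.prod_congr rfl fun j _ => prob_compl_eq_one_sub (hV j)

/-! ### Independence of hitting events -/

section Independence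

variable {Ω X Z : Type*} [MeasurableSpace Ω] [MeasurableSpace X] [MeasurableSpace Z]

/-- The hitting events of pairwise disjoint sets by a marked Poisson process are independent. -/
theorem IsPoissonProcess.measure_forall_exists_mem {μ : Measure Ω} [IsProbabilityMeasure μ]
    {ν : Measure X} [SFinite ν] {Q : Measure Z} [IsProbabilityMeasure Q] {Y : ℕ → Ω → X}
    {S : ℕ → Ω → Z} (hY : IsPoissonProcess μ ν Y) (hS : ∀ i, Measurable (S i))
    (hlaw : ∀ i, μ.map (S i) = Q) (hind : iIndepFun S μ)
    (hYS : IndepFun (fun ω i => Y i ω) (fun ω i => S i ω) μ) {ι : Type*} [Fintype ι]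
    {A : ι → Set (X × Z)} (hA : ∀ j, MeasurableSet (A j))
    (hdisj : Pairwise fun j k => Disjoint (A j) (A k)) (hfin : ∀ j, ν.prod Q (A j) ≠ ∞) :
    μ {ω | ∀ j, ∃ i, (Y i ω, S i ω) ∈ A j} =
      ∏ j, (1 - ENNReal.ofReal (Real.exp (-(ν.prod Q (A j)).toReal))) := by
  have hV : ∀ j, μ {ω | ∀ i, (Y i ω, S i ω) ∉ A j} =
      ENNReal.ofReal (Real.exp (-(ν.prod Q (A j)).toReal)) := fun j =>
    hY.measure_forall_notMem hS hlaw hind hYS (hA j) (hfin j)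
  have hVm : ∀ j, MeasurableSet {ω | ∀ i, (Y i ω, S i ω) ∉ A j} := by
    intro j
    have : {ω | ∀ i, (Y i ω, S i ω) ∉ A j} = ⋂ i, (fun ω => (Y i ω, S i ω)) ⁻¹' (A j)ᶜ := by
      ext ω
      simp
    rw [this]
    exact MeasurableSet.iInter fun i => ((hY.measurable i).prodMk (hS i)) (hA j).compl
  -- Missing several sets is missing their union, whose measure is the sum by disjointness; the
  -- exponential turns the sum into a product.
  have key := measure_iInter_compl_of_measure_biInter (μ := μ) hVm (fun s => by
    have h1 : ⋂ j ∈ s, {ω | ∀ i, (Y i ω, S i ω) ∉ A j} =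
        {ω | ∀ i, (Y i ω, S i ω) ∉ ⋃ j ∈ s, A j} := by
      ext ω
      simp only [mem_iInter, mem_ofPred_eq, mem_iUnion, not_exists]
      exact ⟨fun h i j hj => h j hj i, fun h j hj i => h i j hj⟩
    have h2 : ν.prod Q (⋃ j ∈ s, A j) = ∑ j ∈ s, ν.prod Q (A j) :=
      measure_biUnion_finset (fun j _ k _ hjk => hdisj hjk) fun j _ => hA j
    rw [h1, hY.measure_forall_notMem hS hlaw hind hYS
      (Finset.measurableSet_biUnion _ fun j _ => hA j)
      (by rw [h2]; exact ENNReal.sum_ne_top.2 fun j _ => hfin j), h2,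
      ENNReal.toReal_sum fun j _ => hfin j, ← Finset.sum_neg_distrib, Real.exp_sum,
      ENNReal.ofReal_prod_of_nonneg fun _ _ => (Real.exp_pos _).le]
    exact Finset.prod_congr rfl fun j _ => (hV j).symm)
  have h3 : {ω | ∀ j, ∃ i, (Y i ω, S i ω) ∈ A j} =
      ⋂ j, {ω | ∀ i, (Y i ω, S i ω) ∉ A j}ᶜ := by
    ext ω
    simp
  rw [h3, key]
  exact Finset.prod_congr rfl fun j _ => by rw [hV]

end Independence

/-! ### Geometry of trajectories in the cube -/

section Geometry

variable {n : ℕ}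

/-- The horizontal part of a vector of `ℝ^(n+1)`. -/
def horizontal (x : E (n + 1)) : E n := WithLp.toLp 2 fun i => x i.castSucc

/-- The point of `ℝ^(n+1)` with horizontal part `u` and height `h`. -/
def atHeight (u : E n) (h : ℝ) : E (n + 1) :=
  WithLp.toLp 2 (Fin.snoc (α := fun _ => ℝ) (fun i => u i) h)

/-- The horizontal displacement per unit of height of a direction. -/
noncomputable def slope (s : E (n + 1)) : E n := (s (Fin.last n))⁻¹ • horizontal s

@[simp] lemma horizontal_apply (x : E (n + 1)) (i : Fin n) : horizontal x i = x i.castSucc := rfl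

@[simp] lemma atHeight_castSucc (u : E n) (h : ℝ) (i : Fin n) :
    atHeight u h i.castSucc = u i := by simp [atHeight]

@[simp] lemma atHeight_last (u : E n) (h : ℝ) : atHeight u h (Fin.last n) = h := by
  simp [atHeight]

@[simp] lemma embed_castSucc (u : E n) (i : Fin n) : embed u i.castSucc = u i := by simp [embed]

@[simp] lemma embed_last (u : E n) : embed u (Fin.last n) = 0 := by simp [embed]

@[simp] lemma slope_apply (s : E (n + 1)) (i : Fin n) :
    slope s i = (s (Fin.last n))⁻¹ * s i.castSucc := rfl

lemma measurable_slope : Measurable (slope : E (n + 1) → E n) := by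
  have h1 : Measurable fun s : E (n + 1) => s (Fin.last n) :=
    (EuclideanSpace.proj (𝕜 := ℝ) (Fin.last n)).continuous.measurable
  have h2 : Measurable (horizontal : E (n + 1) → E n) := by
    refine (WithLp.measurable_toLp 2 _).comp (measurable_pi_lambda _ fun i => ?_)
    exact (EuclideanSpace.proj (𝕜 := ℝ) i.castSucc).continuous.measurable
  exact h1.inv.smul h2

lemma norm_sq_eq_horizontal (x : E (n + 1)) :
    ‖x‖ ^ 2 = ‖horizontal x‖ ^ 2 + x (Fin.last n) ^ 2 := by
  rw [EuclideanSpace.norm_sq_eq, EuclideanSpace.norm_sq_eq, Fin.sum_univ_castSucc]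
  simp

lemma norm_horizontal_le (x : E (n + 1)) : ‖horizontal x‖ ≤ ‖x‖ := by
  refine le_of_sq_le_sq ?_ (norm_nonneg _)
  rw [norm_sq_eq_horizontal x]
  nlinarith [sq_nonneg (x (Fin.last n))]

lemma abs_apply_le_norm {m : ℕ} (x : E m) (i : Fin m) : |x i| ≤ ‖x‖ := by
  simpa using PiLp.norm_apply_le x i

lemma norm_le_of_abs_le {x : E n} {c : ℝ} (hc : 0 ≤ c) (h : ∀ i, |x i| ≤ c) : ‖x‖ ≤ n * c := by
  refine le_of_sq_le_sq ?_ (by positivity)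
  rw [EuclideanSpace.norm_sq_eq]
  have h1 : ∑ i, ‖x i‖ ^ 2 ≤ ∑ _i : Fin n, c ^ 2 :=
    Finset.sum_le_sum fun i _ => by
      rw [Real.norm_eq_abs]
      exact pow_le_pow_left₀ (abs_nonneg _) (h i) 2
  have h2 : (n : ℝ) ≤ n ^ 2 := by exact_mod_cast Nat.le_self_pow two_ne_zero n
  simp only [Finset.sum_const, Finset.card_univ, Fintype.card_fin, nsmul_eq_mul] at h1
  nlinarith [sq_nonneg c]

lemma norm_sub_le_of_mem_unitCube {u y : E n} (hu : u ∈ unitCube n) (hy : y ∈ unitCube n) :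
    ‖u - y‖ ≤ n := by
  have := norm_le_of_abs_le (x := u - y) zero_le_one fun i => by
    have h1 := hu i
    have h2 := hy i
    simp only [PiLp.sub_apply]
    rw [abs_le]
    constructor <;> linarith [h1.1, h1.2, h2.1, h2.2]
  simpa using this

/-- A trajectory through a neighbourhood of a point of the upper face of the cube starts near
the point obtained by following its direction backwards. -/
lemma norm_sub_slope_le_of_hit {u y : E n} (hu : u ∈ unitCube n) (hy : y ∈ unitCube n)
    {s : E (n + 1)} {t δ : ℝ} (hδ : δ ≤ 1 / 2)
    (h : ‖atHeight u 1 - (embed y + t • s)‖ ≤ δ) :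
    ‖u - slope s - y‖ ≤ δ * (2 * n + 3) := by
  set e := atHeight u 1 - (embed y + t • s) with he
  -- `τ` is the height reached at time `t`; being within 1/2 of the upper face forces `τ ≥ 1/2`, so
  -- the direction is not horizontal.
  set τ := t * s (Fin.last n) with hτ
  have hel : e (Fin.last n) = 1 - τ := by simp [he, hτ]
  have hτ1 : |1 - τ| ≤ δ := by
    rw [← hel]
    exact (abs_apply_le_norm e _).trans h
  have hτ2 : 1 / 2 ≤ τ := by linarith [(abs_le.1 hτ1).2]
  have hs0 : s (Fin.last n) ≠ 0 := fun h0 => by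
    rw [hτ, h0, mul_zero] at hτ2
    norm_num at hτ2
  have hbase : horizontal e = u - y - τ • slope s := by
    ext i
    simp only [he, hτ, horizontal_apply, PiLp.sub_apply, PiLp.add_apply, PiLp.smul_apply,
      atHeight_castSucc, embed_castSucc, slope_apply, smul_eq_mul]
    field_simp
    ring
  have hb : ‖horizontal e‖ ≤ δ := (norm_horizontal_le e).trans h
  -- Start and target both lie in the unit cube, which bounds the horizontal displacement over a
  -- height of at least 1/2. Moving from height `τ` to height 1 therefore costs at most a multiple
  -- of `δ`.
  have hsl : ‖slope s‖ ≤ 2 * (n + 1) := by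
    have h1 : τ • slope s = (u - y) - horizontal e := by rw [hbase]; abel
    have h2 : τ * ‖slope s‖ ≤ n + δ := by
      rw [← abs_of_nonneg (show 0 ≤ τ by linarith), ← Real.norm_eq_abs, ← norm_smul, h1]
      exact (norm_sub_le _ _).trans (add_le_add (norm_sub_le_of_mem_unitCube hu hy) hb)
    nlinarith [norm_nonneg (slope s)]
  have hfin : u - slope s - y = horizontal e - (1 - τ) • slope s := by
    rw [hbase, sub_smul, one_smul]; abel
  have hδ0 : 0 ≤ δ := (norm_nonneg _).trans h
  calc ‖u - slope s - y‖ ≤ ‖horizontal e‖ + ‖(1 - τ) • slope s‖ := by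
        rw [hfin]; exact norm_sub_le _ _
    _ ≤ δ + δ * (2 * (n + 1)) := by
        rw [norm_smul, Real.norm_eq_abs]
        gcongr
    _ = δ * (2 * n + 3) := by ring

lemma exists_norm_sub_slope_le_of_coverageRadius_lt {y : ℕ → E n} {s : ℕ → E (n + 1)}
    {K : Set (E (n + 1))} {M b : ℝ} (hK : ∀ x ∈ K, ‖x‖ ≤ M) (hMb : b * M ≤ 1 / 2)
    (h : coverageRadius y s K < ENNReal.ofReal b) {u : E n} (hu : u ∈ unitCube n) :
    ∃ i, ‖u - slope (s i) - y i‖ ≤ b * M * (2 * n + 3) := by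
  obtain ⟨R, ⟨r, hr, rfl⟩, hRb⟩ := sInf_lt_iff.1 h
  have hrb : (r : ℝ) ≤ b := by
    rw [← ENNReal.ofReal_coe_nnreal] at hRb
    exact ((ENNReal.ofReal_lt_ofReal_iff_of_nonneg r.coe_nonneg).1 hRb).le
  have hx : atHeight u 1 ∈ unitCube (n + 1) := by
    intro i
    refine Fin.lastCases ?_ (fun i => ?_) i
    · simp
    · simpa using hu i
  have := hr hx
  simp only [cylinderSet, mem_iUnion] at this
  obtain ⟨i, hi, hmem⟩ := this
  obtain ⟨a, ⟨t, -, rfl⟩, k, hk, hak⟩ := Set.mem_add.1 hmem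
  obtain ⟨k', hk', rfl⟩ := Set.mem_smul_set.1 hk
  refine ⟨i, norm_sub_slope_le_of_hit (t := t) hu hi hMb ?_⟩
  rw [← hak, add_sub_cancel_left, norm_smul, Real.norm_eq_abs, abs_of_nonneg r.coe_nonneg]
  exact mul_le_mul hrb (hK _ hk') (norm_nonneg _) (r.coe_nonneg.trans hrb)

/-- The signs of the directions pointing at `u` from inside the cube. -/
noncomputable def inwardSigns (u : E n) : Fin n → SignType := fun i => if 1 / 2 ≤ u i then 1 else -1

lemma inwardSigns_eq (u : E n) (i : Fin n) : inwardSigns u i = 1 ∨ inwardSigns u i = -1 := by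
  unfold inwardSigns
  split_ifs <;> simp

lemma mem_of_mem_closure_signedDirections {z : Fin n → SignType} {s : E (n + 1)}
    (hs : s ∈ closure (signedDirections z)) :
    ‖s‖ = 1 ∧ 2 / √5 ≤ s (Fin.last n) ∧ (∀ i, z i = 1 → 0 ≤ s i.castSucc) ∧
      ∀ i, z i = -1 → s i.castSucc ≤ 0 := by
  have hc : ∀ i, Continuous fun s : E (n + 1) => s i := fun i =>
    (EuclideanSpace.proj (𝕜 := ℝ) i).continuous
  refine ⟨?_, ?_, fun i hi => ?_, fun i hi => ?_⟩
  · exact closure_minimal (fun s hs => hs.1.1) (isClosed_eq continuous_norm continuous_const) hs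
  · exact closure_minimal (fun s hs => hs.2.2) (isClosed_le continuous_const (hc _)) hs
  · refine closure_minimal (t := {s : E (n + 1) | 0 ≤ s i.castSucc}) (fun s hs => ?_)
      (isClosed_le continuous_const (hc _)) hs
    have h1 := hs.2.1 i
    rw [hi] at h1
    exact (sign_eq_one_iff.1 h1).le
  · refine closure_minimal (t := {s : E (n + 1) | s i.castSucc ≤ 0}) (fun s hs => ?_)
      (isClosed_le (hc _) continuous_const) hs
    have h1 := hs.2.1 i
    rw [hi] at h1
    exact (sign_eq_neg_one_iff.1 h1).le

lemma last_pos_of_mem_closure {z : Fin n → SignType} {s : E (n + 1)}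
    (hs : s ∈ closure (signedDirections z)) : 0 < s (Fin.last n) :=
  lt_of_lt_of_le (by positivity) (mem_of_mem_closure_signedDirections hs).2.1

/-- A vertical component of at least 2/√5 leaves at most 1/√5 for the horizontal part of a unit
vector, and the ratio is 1/2. -/
lemma norm_slope_le {z : Fin n → SignType} {s : E (n + 1)}
    (hs : s ∈ closure (signedDirections z)) : ‖slope s‖ ≤ 1 / 2 := by
  obtain ⟨h1, h2, -, -⟩ := mem_of_mem_closure_signedDirections hs
  have hp := last_pos_of_mem_closure hs
  have h3 := norm_sq_eq_horizontal s
  have h4 : 4 / 5 ≤ s (Fin.last n) ^ 2 := by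
    have := pow_le_pow_left₀ (by positivity) h2 2
    rw [div_pow, Real.sq_sqrt (by norm_num)] at this
    linarith
  rw [slope, norm_smul, norm_inv, Real.norm_eq_abs, abs_of_pos hp, inv_mul_le_iff₀ hp]
  refine le_of_sq_le_sq ?_ (by positivity)
  rw [h1] at h3
  nlinarith

/-- Going backwards, coordinates that are at least 1/2 can only decrease and the others can only
increase, in each case by at most 1/2. -/
lemma sub_slope_mem_unitCube {u : E n} (hu : u ∈ unitCube n) {s : E (n + 1)}
    (hs : s ∈ closure (signedDirections (inwardSigns u))) {h : ℝ} (h0 : 0 ≤ h) (h1 : h ≤ 1) :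
    u - h • slope s ∈ unitCube n := by
  intro i
  obtain ⟨-, -, hpos, hneg⟩ := mem_of_mem_closure_signedDirections hs
  have hp := last_pos_of_mem_closure hs
  have hb : |slope s i| ≤ 1 / 2 := (abs_apply_le_norm _ i).trans (norm_slope_le hs)
  obtain ⟨hb1, hb2⟩ := abs_le.1 hb
  obtain ⟨hu0, hu1⟩ := hu i
  have hval : (u - h • slope s) i = u i - h * slope s i := by simp
  rw [hval]
  by_cases hi : 1 / 2 ≤ u i
  · have h2 : 0 ≤ slope s i := by
      have := hpos i (if_pos hi)
      rw [slope_apply]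
      positivity
    constructor <;> nlinarith
  · have h2 : slope s i ≤ 0 := by
      have := hneg i (if_neg hi)
      rw [slope_apply]
      exact mul_nonpos_of_nonneg_of_nonpos (by positivity) this
    push Not at hi
    constructor <;> nlinarith

/-- The trajectory is compared with the target at the same height `h`, reached at time `h / s_d`.
The difference is then horizontal, so the flat ball in `K` suffices. -/
lemma mem_trajectory_add_smul {u y : E n} {s : E (n + 1)} {h r r₀ : ℝ} {K : Set (E (n + 1))}
    (hK : flatBall n r₀ ⊆ K) (hr : 0 < r) (h0 : 0 ≤ h) (hs : 0 < s (Fin.last n))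
    (hd : ‖u - h • slope s - y‖ ≤ r * r₀) : atHeight u h ∈ trajectory y s + r • K := by
  refine Set.mem_add.2 ⟨embed y + (h / s (Fin.last n)) • s, ⟨_, by positivity, rfl⟩,
    embed (u - h • slope s - y), ?_, ?_⟩
  · refine Set.mem_smul_set.2 ⟨embed (r⁻¹ • (u - h • slope s - y)), hK ⟨_, ?_, rfl⟩, ?_⟩
    · rw [mem_closedBall_zero_iff, norm_smul, norm_inv, Real.norm_eq_abs, abs_of_pos hr,
        inv_mul_le_iff₀ hr]
      exact hd
    · ext i
      refine Fin.lastCases ?_ (fun i => ?_) i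
      · simp
      · simp [hr.ne']
  · ext i
    refine Fin.lastCases ?_ (fun i => ?_) i
    · simp [hs.ne']
    · simp only [PiLp.add_apply, PiLp.smul_apply, PiLp.sub_apply, embed_castSucc,
        atHeight_castSucc, slope_apply, smul_eq_mul]
      field_simp
      ring

/-- The points of the grid of mesh `1 / N` in the unit cube. -/
noncomputable def gridPoint (N : ℕ) (g : Fin n → Fin (N + 1)) : E n :=
  WithLp.toLp 2 fun i => ((g i : ℕ) : ℝ) / N

lemma grid_mem_Icc {N : ℕ} (k : Fin (N + 1)) : ((k : ℕ) : ℝ) / N ∈ Icc (0 : ℝ) 1 :=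
  ⟨by positivity, div_le_one_of_le₀ (by exact_mod_cast Nat.lt_succ_iff.1 k.2) (by positivity)⟩

lemma gridPoint_mem_unitCube {N : ℕ} (g : Fin n → Fin (N + 1)) : gridPoint N g ∈ unitCube n :=
  fun i => grid_mem_Icc (g i)

lemma exists_grid_near {N : ℕ} (hN : 0 < N) {a : ℝ} (ha : a ∈ Icc (0 : ℝ) 1) :
    ∃ k : Fin (N + 1), |a - ((k : ℕ) : ℝ) / N| ≤ 1 / N := by
  have hN' : (0 : ℝ) < N := by exact_mod_cast hN
  have h0 : 0 ≤ a * N := mul_nonneg ha.1 hN'.le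
  have hle : ⌊a * N⌋₊ ≤ N := by
    refine Nat.floor_le_of_le ?_
    nlinarith [ha.2]
  refine ⟨⟨⌊a * N⌋₊, Nat.lt_succ_of_le hle⟩, ?_⟩
  have h1 := Nat.floor_le h0
  have h2 := Nat.lt_floor_add_one (a * N)
  have h3 : a - (⌊a * N⌋₊ : ℝ) / N = (a * N - ⌊a * N⌋₊) / N := by field_simp
  rw [h3, abs_div, abs_of_pos hN', abs_of_nonneg (by linarith)]
  exact div_le_div_of_nonneg_right (by linarith) hN'.le

/-- The allowed error `r * r₀` is split into 1/2 for the grid point, 1/4 for the horizontal rounding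
and 1/4 for the rounding of the height, which is multiplied by a slope of norm at most 1/2. -/
lemma coverageRadius_le_of_grid (hn : 1 ≤ n) {y : ℕ → E n} {s : ℕ → E (n + 1)}
    {K : Set (E (n + 1))}
    {r r₀ : ℝ} (hK : flatBall n r₀ ⊆ K) (hr : 0 < r) {N : ℕ} (hN : 0 < N)
    (hmesh : (n : ℝ) / N ≤ r * r₀ / 4)
    (hgrid : ∀ (g : Fin n → Fin (N + 1)) (k : Fin (N + 1)), ∃ i, y i ∈ unitCube n ∧
      s i ∈ closure (signedDirections (inwardSigns (gridPoint N g))) ∧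
      ‖gridPoint N g - (((k : ℕ) : ℝ) / N) • slope (s i) - y i‖ ≤ r * r₀ / 2) :
    coverageRadius y s K ≤ ENNReal.ofReal r := by
  refine sInf_le ⟨r.toNNReal, fun x hx => ?_, rfl⟩
  rw [Real.coe_toNNReal _ hr.le]
  have hN' : (0 : ℝ) < N := by exact_mod_cast hN
  choose g hg using fun i : Fin n => exists_grid_near hN (hx i.castSucc)
  obtain ⟨k, hk⟩ := exists_grid_near hN (hx (Fin.last n))
  obtain ⟨i, hi, hs, hd⟩ := hgrid g k
  simp only [cylinderSet, mem_iUnion]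
  refine ⟨i, hi, ?_⟩
  have hxe : x = atHeight (horizontal x) (x (Fin.last n)) := by
    ext j
    refine Fin.lastCases ?_ (fun j => ?_) j <;> simp
  rw [hxe]
  refine mem_trajectory_add_smul hK hr (hx _).1 (last_pos_of_mem_closure hs) ?_
  have h1 : ‖horizontal x - gridPoint N g‖ ≤ r * r₀ / 4 := by
    refine (norm_le_of_abs_le (c := 1 / N) (by positivity) fun j => ?_).trans ?_
    · simpa [gridPoint] using hg j
    · rwa [mul_one_div]
  have hn1 : (1 : ℝ) / N ≤ (n : ℝ) / N := by
    gcongr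
    exact_mod_cast hn
  have h2 : ‖(x (Fin.last n) - ((k : ℕ) : ℝ) / N) • slope (s i)‖ ≤ r * r₀ / 4 := by
    rw [norm_smul, Real.norm_eq_abs]
    have := norm_slope_le hs
    nlinarith [abs_nonneg (x (Fin.last n) - ((k : ℕ) : ℝ) / N), norm_nonneg (slope (s i))]
  have h3 : horizontal x - x (Fin.last n) • slope (s i) - y i =
      (horizontal x - gridPoint N g) - (x (Fin.last n) - ((k : ℕ) : ℝ) / N) • slope (s i) +
        (gridPoint N g - (((k : ℕ) : ℝ) / N) • slope (s i) - y i) := by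
    rw [sub_smul]; abel
  rw [h3]
  refine (norm_add_le _ _).trans ?_
  linarith [norm_sub_le (horizontal x - gridPoint N g)
    ((x (Fin.last n) - ((k : ℕ) : ℝ) / N) • slope (s i))]

lemma isClosed_unitCube (m : ℕ) : IsClosed (unitCube m) := by
  have : unitCube m = ⋂ i, {x : E m | x i ∈ Icc (0 : ℝ) 1} := by
    ext x
    simp [unitCube]
  rw [this]
  exact isClosed_iInter fun i =>
    isClosed_Icc.preimage (EuclideanSpace.proj (𝕜 := ℝ) i).continuous

/-- A box of side `ε` with one corner at `q`, extended in each coordinate away from the nearer face,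
stays in the cube; its points are within `ε` of `q` coordinatewise. -/
lemma ofReal_pow_le_volume_unitCube_inter_closedBall {q : E n} (hq : q ∈ unitCube n) {ε : ℝ}
    (h0 : 0 ≤ ε) (h1 : ε ≤ 1 / 2) :
    ENNReal.ofReal (ε ^ n) ≤ volume (unitCube n ∩ Metric.closedBall q (n * ε)) := by
  let lo : Fin n → ℝ := fun i => if 1 / 2 ≤ q i then q i - ε else q i
  have hvol : volume ((WithLp.ofLp : E n → Fin n → ℝ) ⁻¹'
      Set.pi univ fun i => Icc (lo i) (lo i + ε)) = ENNReal.ofReal (ε ^ n) := by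
    rw [(PiLp.volume_preserving_ofLp (Fin n)).measure_preimage
      (MeasurableSet.univ_pi fun i => measurableSet_Icc).nullMeasurableSet, volume_pi_pi]
    simp [ENNReal.ofReal_pow h0]
  rw [← hvol]
  refine measure_mono fun x hx => ?_
  have hx' : ∀ i, x i ∈ Icc (lo i) (lo i + ε) := fun i => hx i (mem_univ i)
  constructor
  · intro i
    obtain ⟨h2, h3⟩ := hx' i
    obtain ⟨h4, h5⟩ := hq i
    simp only [lo] at h2 h3
    split_ifs at h2 h3 with hi
    · constructor <;> linarith
    · push Not at hi
      constructor <;> linarith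
  · rw [mem_closedBall_iff_norm]
    refine norm_le_of_abs_le h0 fun i => ?_
    obtain ⟨h2, h3⟩ := hx' i
    simp only [lo] at h2 h3
    rw [PiLp.sub_apply, abs_le]
    split_ifs at h2 h3 with hi <;> constructor <;> linarith

end Geometry

/-! ### Probability bounds at fixed intensity -/

section Bounds

variable {n : ℕ} {Ω : Type*} [MeasurableSpace Ω] {μ : Measure Ω} [IsProbabilityMeasure μ]
  {Q : Measure (E (n + 1))} [IsProbabilityMeasure Q] {ρ : ℝ} {Y : ℕ → Ω → E n}
  {S : ℕ → Ω → E (n + 1)}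

lemma measurableSet_norm_sub_slope_le (u : E n) (h D : ℝ) :
    MeasurableSet {p : E n × E (n + 1) | ‖u - h • slope p.2 - p.1‖ ≤ D} :=
  measurableSet_le ((measurable_const.sub
    ((measurable_slope.comp measurable_snd).const_smul h)).sub measurable_fst).norm
    measurable_const

/-- For each fixed direction the slice is a ball of radius `D`; the slope only translates its
centre, so the value does not depend on `Q`. -/
lemma prod_norm_sub_slope_le (hρ : 0 ≤ ρ) (u : E n) {D : ℝ} (hD : 0 ≤ D) :
    (ENNReal.ofReal ρ • (volume : Measure (E n))).prod Q
        {p : E n × E (n + 1) | ‖u - (1 : ℝ) • slope p.2 - p.1‖ ≤ D} =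
      ENNReal.ofReal (ρ * (D ^ n * volume.real (Metric.closedBall (0 : E n) 1))) := by
  rw [Measure.prod_apply_symm (measurableSet_norm_sub_slope_le u 1 D)]
  have : ∀ s : E (n + 1), (ENNReal.ofReal ρ • (volume : Measure (E n)))
      ((fun y => (y, s)) ⁻¹' {p : E n × E (n + 1) | ‖u - (1 : ℝ) • slope p.2 - p.1‖ ≤ D}) =
      ENNReal.ofReal (ρ * (D ^ n * volume.real (Metric.closedBall (0 : E n) 1))) := by
    intro s
    have h1 : (fun y => (y, s)) ⁻¹' {p : E n × E (n + 1) | ‖u - (1 : ℝ) • slope p.2 - p.1‖ ≤ D} =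
        Metric.closedBall (u - slope s) D := by
      ext y
      simp [dist_eq_norm, norm_sub_rev y]
    rw [h1, Measure.smul_apply, smul_eq_mul, Measure.addHaar_closedBall' _ _ hD,
      ENNReal.ofReal_mul hρ, ENNReal.ofReal_mul (by positivity), finrank_euclideanSpace_fin,
      ofReal_measureReal (by exact measure_closedBall_lt_top.ne)]
  rw [lintegral_congr this, lintegral_const, measure_univ, mul_one]

lemma IsLineModel.measure_coverageRadius_lt_le (hmodel : IsLineModel μ Q ρ Y S) (hn : 1 ≤ n)
    (hρ : 0 ≤ ρ) {K : Set (E (n + 1))} {M b : ℝ} (hM : 0 ≤ M) (hb : 0 ≤ b)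
    (hK : ∀ x ∈ K, ‖x‖ ≤ M) (hMb : b * M ≤ 1 / 2) {m : ℕ}
    (hsep : 2 * (b * M * (2 * n + 3)) < 1 / m) :
    μ {ω | coverageRadius (fun i => Y i ω) (fun i => S i ω) K < ENNReal.ofReal b} ≤
      ENNReal.ofReal ((1 - Real.exp (-(ρ * ((b * M * (2 * n + 3)) ^ n *
        volume.real (Metric.closedBall (0 : E n) 1))))) ^ m) := by
  set D := b * M * (2 * n + 3) with hD
  have hD0 : 0 ≤ D := by positivity
  have hm : (0 : ℝ) < m := by
    rcases Nat.eq_zero_or_pos m with rfl | h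
    · simp only [Nat.cast_zero, div_zero] at hsep
      linarith
    · exact_mod_cast h
  -- Test points on the diagonal: their first coordinates already differ by at least `1 / m > 2 *
  -- D`. A common pair (start, direction) would bring two of them within `2 * D`, since the same
  -- slope is subtracted from both.
  let u : Fin m → E n := fun j => WithLp.toLp 2 fun _ => ((j : ℕ) : ℝ) / m
  have hu : ∀ j, u j ∈ unitCube n := fun j i =>
    ⟨by positivity, div_le_one_of_le₀ (by exact_mod_cast j.2.le) hm.le⟩
  let A : Fin m → Set (E n × E (n + 1)) := fun j =>
    {p | ‖u j - (1 : ℝ) • slope p.2 - p.1‖ ≤ D}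
  have hdisj : Pairwise fun j k => Disjoint (A j) (A k) := by
    intro j k hjk
    refine Set.disjoint_left.2 fun p hj hk => ?_
    have hj' : ‖u j - (1 : ℝ) • slope p.2 - p.1‖ ≤ D := hj
    have hk' : ‖u k - (1 : ℝ) • slope p.2 - p.1‖ ≤ D := hk
    have h1 : ‖u j - u k‖ ≤ 2 * D := by
      have : u j - u k = (u j - (1 : ℝ) • slope p.2 - p.1) -
        (u k - (1 : ℝ) • slope p.2 - p.1) := by abel
      rw [this]
      exact (norm_sub_le _ _).trans (by linarith)
    have h2 : |(u j - u k) ⟨0, hn⟩| ≤ ‖u j - u k‖ := abs_apply_le_norm _ _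
    have h3 : (u j - u k) ⟨0, hn⟩ = (((j : ℕ) : ℝ) - ((k : ℕ) : ℝ)) / m := by
      simp [u, sub_div]
    have h4 : (1 : ℝ) ≤ |((j : ℕ) : ℝ) - ((k : ℕ) : ℝ)| := by
      have : (1 : ℤ) ≤ |((j : ℕ) : ℤ) - ((k : ℕ) : ℤ)| := by
        refine Int.one_le_abs (sub_ne_zero.2 fun h => hjk (Fin.ext ?_))
        exact_mod_cast h
      exact_mod_cast this
    rw [h3, abs_div, abs_of_pos hm] at h2
    have h5 : 1 / (m : ℝ) ≤ |((j : ℕ) : ℝ) - ((k : ℕ) : ℝ)| / m :=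
      div_le_div_of_nonneg_right h4 hm.le
    linarith
  have hAν := fun j => prod_norm_sub_slope_le (Q := Q) hρ (u j) hD0
  have key := hmodel.points.measure_forall_exists_mem hmodel.measurable_dir hmodel.law_dir
    hmodel.indep_dir hmodel.indep_points_dir (A := A)
    (fun j => measurableSet_norm_sub_slope_le _ _ _) hdisj
    (fun j => by rw [hAν]; exact ENNReal.ofReal_ne_top)
  calc _ ≤ μ {ω | ∀ j, ∃ i, (Y i ω, S i ω) ∈ A j} := by
        refine measure_mono fun ω hω j => ?_
        obtain ⟨i, hi⟩ := exists_norm_sub_slope_le_of_coverageRadius_lt hK hMb hω (hu j)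
        exact ⟨i, by simpa [A] using hi⟩
    _ = _ := by
        rw [key]
        simp only [A, hAν]
        rw [Finset.prod_const, Finset.card_univ, Fintype.card_fin,
          ENNReal.toReal_ofReal (by positivity), ENNReal.ofReal_pow, ENNReal.ofReal_sub _
          (Real.exp_pos _).le, ENNReal.ofReal_one]
        rw [sub_nonneg, Real.exp_le_one_iff, neg_nonpos]
        positivity

lemma volume_unitCube_lt_top : volume (unitCube n) < ∞ := by
  refine lt_of_le_of_lt (measure_mono fun x hx => ?_)
    (measure_closedBall_lt_top (x := (0 : E n)) (r := n))
  rw [mem_closedBall_zero_iff]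
  have := norm_sub_le_of_mem_unitCube hx (y := 0) (fun i => by simp)
  simpa using this

/-- For each direction in the sector, the backtracked point lies in the cube and has admissible
starts of volume at least `ε ^ n` around it. Integrating over the sector bounds the intensity of
suitable pairs from below. -/
lemma IsLineModel.measure_forall_notMem_le (hmodel : IsLineModel μ Q ρ Y S) (hρ : 0 ≤ ρ)
    {p ε w : ℝ} (hp : 0 ≤ p) {u : E n} (hu : u ∈ unitCube n)
    (hpQ : ENNReal.ofReal p ≤ Q (closure (signedDirections (inwardSigns u))))
    {h : ℝ} (h0 : 0 ≤ h) (h1 : h ≤ 1) (hε0 : 0 ≤ ε) (hε1 : ε ≤ 1 / 2) (hw : n * ε ≤ w) :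
    μ {ω | ∀ i, ¬ (Y i ω ∈ unitCube n ∧
        S i ω ∈ closure (signedDirections (inwardSigns u)) ∧
        ‖u - h • slope (S i ω) - Y i ω‖ ≤ w)} ≤
      ENNReal.ofReal (Real.exp (-(ρ * (ε ^ n * p)))) := by
  set C := closure (signedDirections (inwardSigns u)) with hC
  let A : Set (E n × E (n + 1)) :=
    {q | q.1 ∈ unitCube n ∧ q.2 ∈ C ∧ ‖u - h • slope q.2 - q.1‖ ≤ w}
  have hA : MeasurableSet A :=
    (measurable_fst (isClosed_unitCube n).measurableSet).inter
      ((measurable_snd isClosed_closure.measurableSet).inter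
        (measurableSet_norm_sub_slope_le u h w))
  have hfin : (ENNReal.ofReal ρ • (volume : Measure (E n))).prod Q A ≠ ∞ := by
    refine (lt_of_le_of_lt (measure_mono (t := unitCube n ×ˢ univ) fun q hq =>
      ⟨hq.1, mem_univ _⟩) ?_).ne
    rw [Measure.prod_prod, measure_univ, mul_one, Measure.smul_apply, smul_eq_mul]
    exact ENNReal.mul_lt_top ENNReal.ofReal_lt_top volume_unitCube_lt_top
  have hlow : ENNReal.ofReal (ρ * (ε ^ n * p)) ≤
      (ENNReal.ofReal ρ • (volume : Measure (E n))).prod Q A := by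
    rw [Measure.prod_apply_symm hA]
    calc ENNReal.ofReal (ρ * (ε ^ n * p))
        = ENNReal.ofReal ρ * ENNReal.ofReal (ε ^ n) * ENNReal.ofReal p := by
          rw [ENNReal.ofReal_mul hρ, ENNReal.ofReal_mul (by positivity), mul_assoc]
      _ ≤ ENNReal.ofReal ρ * ENNReal.ofReal (ε ^ n) * Q C := by gcongr
      _ = ∫⁻ _ in C, ENNReal.ofReal ρ * ENNReal.ofReal (ε ^ n) ∂Q := by
          rw [setLIntegral_const]
      _ ≤ ∫⁻ s in C, (ENNReal.ofReal ρ • (volume : Measure (E n)))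
            ((fun y => (y, s)) ⁻¹' A) ∂Q := by
          refine setLIntegral_mono' isClosed_closure.measurableSet fun s hs => ?_
          rw [Measure.smul_apply, smul_eq_mul]
          gcongr
          refine (ofReal_pow_le_volume_unitCube_inter_closedBall
            (sub_slope_mem_unitCube hu hs h0 h1) hε0 hε1).trans (measure_mono fun y hy => ?_)
          refine ⟨hy.1, hs, ?_⟩
          have := hy.2
          rw [Metric.mem_closedBall, dist_eq_norm, norm_sub_rev] at this
          exact this.trans hw
      _ ≤ _ := setLIntegral_le_lintegral _ _
  have key := hmodel.points.measure_forall_notMem hmodel.measurable_dir hmodel.law_dir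
    hmodel.indep_dir hmodel.indep_points_dir hA hfin
  calc _ = _ := key
    _ ≤ _ := by
      refine ENNReal.ofReal_le_ofReal (Real.exp_le_exp.2 (neg_le_neg ?_))
      rw [← ENNReal.toReal_ofReal (show 0 ≤ ρ * (ε ^ n * p) by positivity)]
      exact ENNReal.toReal_mono hfin hlow

/-- Union bound over the `(N + 1) ^ n` horizontal positions and `N + 1` heights of the grid. -/
lemma IsLineModel.measure_lt_coverageRadius_le (hmodel : IsLineModel μ Q ρ Y S) (hn : 1 ≤ n)
    (hρ : 0 ≤ ρ) {K : Set (E (n + 1))} {r r₀ p ε : ℝ} (hK : flatBall n r₀ ⊆ K) (hr : 0 < r)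
    (hp : 0 ≤ p) (hpQ : ∀ z : Fin n → SignType, (∀ i, z i = 1 ∨ z i = -1) →
      ENNReal.ofReal p ≤ Q (closure (signedDirections z)))
    (hε0 : 0 ≤ ε) (hε1 : ε ≤ 1 / 2) (hεr : n * ε ≤ r * r₀ / 2) {N : ℕ} (hN : 0 < N)
    (hmesh : (n : ℝ) / N ≤ r * r₀ / 4) :
    μ {ω | ENNReal.ofReal r < coverageRadius (fun i => Y i ω) (fun i => S i ω) K} ≤
      ENNReal.ofReal ((N + 1) ^ (n + 1) * Real.exp (-(ρ * (ε ^ n * p)))) := by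
  let V : (Fin n → Fin (N + 1)) × Fin (N + 1) → Set Ω := fun q =>
    {ω | ∀ i, ¬ (Y i ω ∈ unitCube n ∧
        S i ω ∈ closure (signedDirections (inwardSigns (gridPoint N q.1))) ∧
        ‖gridPoint N q.1 - (((q.2 : ℕ) : ℝ) / N) • slope (S i ω) - Y i ω‖ ≤ r * r₀ / 2)}
  have hV : ∀ q, μ (V q) ≤ ENNReal.ofReal (Real.exp (-(ρ * (ε ^ n * p)))) := fun q =>
    hmodel.measure_forall_notMem_le hρ hp (gridPoint_mem_unitCube _)
      (hpQ _ (inwardSigns_eq _)) (grid_mem_Icc _).1 (grid_mem_Icc _).2 hε0 hε1 hεr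
  calc _ ≤ μ (⋃ q, V q) := by
        refine measure_mono fun ω hω => ?_
        by_contra hnot
        refine (not_le.2 hω) (coverageRadius_le_of_grid hn hK hr hN hmesh fun g k => ?_)
        by_contra hgk
        exact hnot (mem_iUnion.2 ⟨(g, k), not_exists.1 hgk⟩)
    _ ≤ ∑ q, μ (V q) := measure_iUnion_fintype_le _ _
    _ ≤ ∑ _q : (Fin n → Fin (N + 1)) × Fin (N + 1),
          ENNReal.ofReal (Real.exp (-(ρ * (ε ^ n * p)))) := Finset.sum_le_sum fun q _ => hV q
    _ = _ := by
        rw [Finset.sum_const, Finset.card_univ, Fintype.card_prod, Fintype.card_fun,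
          Fintype.card_fin, Fintype.card_fin, ENNReal.ofReal_mul (by positivity), nsmul_eq_mul,
          ← pow_succ]
        congr 1
        rw [← ENNReal.ofReal_natCast]
        push_cast
        rfl

end Bounds

/-! ### Asymptotics of the coverage scale and of the two bounds -/

section Asymptotics

/-- The order of magnitude of the coverage radius. -/
noncomputable def coverageScale (n : ℕ) (ρ : ℝ) : ℝ := (Real.log ρ / ρ) ^ (1 / (n : ℝ))

lemma log_div_pos {ρ : ℝ} (hρ : 1 < ρ) : 0 < Real.log ρ / ρ :=
  div_pos (Real.log_pos hρ) (by linarith)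

lemma coverageScale_pos {n : ℕ} {ρ : ℝ} (hρ : 1 < ρ) : 0 < coverageScale n ρ :=
  Real.rpow_pos_of_pos (log_div_pos hρ) _

lemma coverageScale_pow {n : ℕ} (hn : 1 ≤ n) {ρ : ℝ} (hρ : 1 < ρ) :
    coverageScale n ρ ^ n = Real.log ρ / ρ := by
  rw [coverageScale, one_div]
  exact Real.rpow_inv_natCast_pow (log_div_pos hρ).le (by omega)

/-- The product equals (log ρ / √ρ)^(1/n). It lets ρ^(1/(2n)) test points have spacing much larger
than the scale. -/
lemma tendsto_coverageScale_mul_rpow {n : ℕ} (hn : 1 ≤ n) :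
    Tendsto (fun ρ : ℝ => coverageScale n ρ * ρ ^ (1 / (2 * n) : ℝ)) atTop (𝓝 0) := by
  have hn0 : (0 : ℝ) < n := by exact_mod_cast hn
  have h1 : Tendsto (fun ρ : ℝ => Real.log ρ / ρ ^ (1 / 2 : ℝ)) atTop (𝓝 0) :=
    (isLittleO_log_rpow_atTop (by norm_num)).tendsto_div_nhds_zero
  have h2 := h1.rpow_const (p := 1 / (n : ℝ)) (Or.inr (by positivity))
  rw [Real.zero_rpow (by positivity)] at h2
  refine h2.congr' ?_
  filter_upwards [eventually_gt_atTop 1] with ρ hρ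
  have hρ0 : 0 < ρ := by linarith
  have h3 : (ρ : ℝ) ^ (1 / (2 * n) : ℝ) = (ρ ^ (1 / 2 : ℝ)) ^ (1 / (n : ℝ)) := by
    rw [← Real.rpow_mul hρ0.le]
    congr 1
    field_simp
  rw [coverageScale, h3, ← Real.mul_rpow (log_div_pos hρ).le (by positivity)]
  congr 1
  have h4 : ρ = ρ ^ (1 / 2 : ℝ) * ρ ^ (1 / 2 : ℝ) := by
    rw [← Real.rpow_add hρ0]
    norm_num
  have h5 : (0 : ℝ) < ρ ^ (1 / 2 : ℝ) := by positivity
  field_simp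
  rw [sq]
  linear_combination Real.log ρ * h4

lemma tendsto_coverageScale {n : ℕ} (hn : 1 ≤ n) :
    Tendsto (coverageScale n) atTop (𝓝 0) := by
  refine squeeze_zero' ?_ ?_ (tendsto_coverageScale_mul_rpow hn)
  · filter_upwards [eventually_gt_atTop 1] with ρ hρ using (coverageScale_pos hρ).le
  · filter_upwards [eventually_gt_atTop 1] with ρ hρ
    exact le_mul_of_one_le_right (coverageScale_pos hρ).le
      (Real.one_le_rpow hρ.le (by positivity))

lemma inv_le_coverageScale {n : ℕ} (hn : 1 ≤ n) {ρ : ℝ} (hρ : Real.exp 1 ≤ ρ) :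
    1 / ρ ≤ coverageScale n ρ := by
  have hρ1 : 1 < ρ := lt_of_lt_of_le (by simp) hρ
  have hlog : 1 ≤ Real.log ρ := (Real.le_log_iff_exp_le (by linarith)).2 hρ
  have hn1 : (1 : ℝ) ≤ n := by exact_mod_cast hn
  calc 1 / ρ = (1 / ρ) ^ (1 : ℝ) := (Real.rpow_one _).symm
    _ ≤ (1 / ρ) ^ (1 / (n : ℝ)) :=
        Real.rpow_le_rpow_of_exponent_ge (by positivity)
          (div_le_one_of_le₀ hρ1.le (by linarith)) (div_le_one_of_le₀ hn1 (by linarith))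
    _ ≤ _ := by
        unfold coverageScale
        gcongr

/-- Each miss probability is at least ρ^(-1/(4n)); times about ρ^(1/(2n)) trials this gives
ρ^(1/(4n)) expected misses up to a bounded error, and `1 - q ≤ exp (-q)` finishes. -/
lemma tendsto_one_sub_exp_pow {n : ℕ} (hn : 1 ≤ n) {κ : ℝ} (hκ0 : 0 ≤ κ)
    (hκ : κ ≤ 1 / (4 * n)) :
    Tendsto (fun ρ : ℝ => (1 - Real.exp (-(κ * Real.log ρ))) ^ ⌊ρ ^ (1 / (2 * n) : ℝ)⌋₊)
      atTop (𝓝 0) := by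
  have hn0 : (0 : ℝ) < n := by exact_mod_cast hn
  have hlim : Tendsto (fun ρ : ℝ => Real.exp (-(ρ ^ (1 / (4 * n) : ℝ) - 1))) atTop (𝓝 0) :=
    Real.tendsto_exp_neg_atTop_nhds_zero.comp
      (tendsto_atTop_add_const_right _ (-1) (tendsto_rpow_atTop (by positivity)))
  refine squeeze_zero' ?_ ?_ hlim
  · filter_upwards [eventually_gt_atTop 1] with ρ hρ
    refine pow_nonneg ?_ _
    rw [sub_nonneg, Real.exp_le_one_iff, neg_nonpos]
    exact mul_nonneg hκ0 (Real.log_nonneg hρ.le)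
  · filter_upwards [eventually_gt_atTop 1] with ρ hρ
    have hρ0 : 0 < ρ := by linarith
    set q := Real.exp (-(κ * Real.log ρ)) with hq
    have hq1 : q ≤ 1 := by
      rw [hq, Real.exp_le_one_iff, neg_nonpos]
      exact mul_nonneg hκ0 (Real.log_nonneg hρ.le)
    have hqlow : ρ ^ (-(1 / (4 * n)) : ℝ) ≤ q := by
      rw [Real.rpow_def_of_pos hρ0, hq]
      refine Real.exp_le_exp.2 ?_
      nlinarith [Real.log_pos hρ]
    set m := ⌊ρ ^ (1 / (2 * n) : ℝ)⌋₊ with hm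
    have hm1 : ρ ^ (1 / (2 * n) : ℝ) - 1 ≤ m := (Nat.sub_one_lt_floor _).le
    have hx : ρ ^ (1 / (4 * n) : ℝ) = ρ ^ (-(1 / (4 * n)) : ℝ) * ρ ^ (1 / (2 * n) : ℝ) := by
      rw [← Real.rpow_add hρ0]
      congr 1
      field_simp
      norm_num
    have hpow1 : 1 ≤ ρ ^ (1 / (2 * n) : ℝ) := Real.one_le_rpow hρ.le (by positivity)
    have hqm : ρ ^ (1 / (4 * n) : ℝ) - 1 ≤ q * m := by
      have h1 : ρ ^ (-(1 / (4 * n)) : ℝ) ≤ 1 := hqlow.trans hq1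
      have h2 : (0 : ℝ) < ρ ^ (-(1 / (4 * n)) : ℝ) := by positivity
      calc ρ ^ (1 / (4 * n) : ℝ) - 1
          ≤ ρ ^ (-(1 / (4 * n)) : ℝ) * (ρ ^ (1 / (2 * n) : ℝ) - 1) := by
            rw [hx]; linarith
        _ ≤ q * m := mul_le_mul hqlow hm1 (by linarith) (h2.le.trans hqlow)
    calc (1 - q) ^ m ≤ Real.exp (-q) ^ m :=
          pow_le_pow_left₀ (by linarith) (Real.one_sub_le_exp_neg q) m
      _ = Real.exp (-(q * m)) := by rw [← Real.exp_nat_mul]; congr 1; ring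
      _ ≤ _ := Real.exp_le_exp.2 (by linarith)

/-- The grid has at most a constant times ρ^(2n+2) points, so a decay of ρ^(-(2n+3)) leaves a factor
1/ρ. -/
lemma tendsto_grid_mul_exp {n : ℕ} {κ : ℝ} (hκ : 2 * n + 3 ≤ κ) :
    Tendsto (fun ρ : ℝ => ((⌈ρ ^ 2⌉₊ : ℝ) + 1) ^ (n + 1) * Real.exp (-(κ * Real.log ρ)))
      atTop (𝓝 0) := by
  have hlim : Tendsto (fun ρ : ℝ => (2 : ℝ) ^ (n + 1) * ρ⁻¹) atTop (𝓝 0) := by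
    simpa using tendsto_inv_atTop_zero.const_mul ((2 : ℝ) ^ (n + 1))
  refine squeeze_zero' (Eventually.of_forall fun ρ => by positivity) ?_ hlim
  filter_upwards [eventually_ge_atTop 2] with ρ hρ
  have hρ0 : 0 < ρ := by linarith
  have h1 : (⌈ρ ^ 2⌉₊ : ℝ) + 1 ≤ 2 * ρ ^ 2 := by
    have := Nat.ceil_lt_add_one (show 0 ≤ ρ ^ 2 by positivity)
    nlinarith
  have h2 : Real.exp (-(κ * Real.log ρ)) ≤ (ρ ^ (2 * n + 3))⁻¹ := by
    rw [Real.exp_neg, ← Real.exp_log (show 0 < ρ ^ (2 * n + 3) by positivity), Real.log_pow]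
    refine inv_anti₀ (Real.exp_pos _) (Real.exp_le_exp.2 ?_)
    push_cast
    exact mul_le_mul_of_nonneg_right hκ (Real.log_nonneg (by linarith))
  calc _ ≤ (2 * ρ ^ 2) ^ (n + 1) * (ρ ^ (2 * n + 3))⁻¹ := by gcongr
    _ = _ := by
      have : ρ ^ (2 * n + 3) = (ρ ^ 2) ^ (n + 1) * ρ := by ring
      rw [this, mul_pow]
      field_simp

end Asymptotics

/-! ### Choice of constants and the two one-sided bounds -/

/-- With high probability the coverage radius is at least of the order `(log ρ / ρ) ^ (1 / n)`. -/
theorem exists_tendsto_measure_coverageRadius_lt.{u} {n : ℕ} (hn : 1 ≤ n) {K : Set (E (n + 1))}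
    (hK : Bornology.IsBounded K) (Q : Measure (E (n + 1))) [IsProbabilityMeasure Q] :
    ∃ c : ℝ, 0 < c ∧ ∀ (Ω : Type u) [MeasurableSpace Ω] (μ : Measure Ω) [IsProbabilityMeasure μ]
      (Y : ℝ → ℕ → Ω → E n) (S : ℝ → ℕ → Ω → E (n + 1)),
      (∀ ρ : ℝ, 0 < ρ → IsLineModel μ Q ρ (Y ρ) (S ρ)) →
      Tendsto (fun ρ : ℝ => μ {ω | coverageRadius (fun i => Y ρ i ω) (fun i => S ρ i ω) K <
        ENNReal.ofReal (c * coverageScale n ρ)}) atTop (𝓝 0) := by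
  obtain ⟨M, hM0, hM⟩ := hK.exists_pos_norm_le
  have hn0 : (0 : ℝ) < n := by exact_mod_cast hn
  set v := volume.real (Metric.closedBall (0 : E n) 1) with hv
  have hv0 : 0 < v := by
    rw [hv, measureReal_def]
    exact ENNReal.toReal_pos (Metric.measure_closedBall_pos _ _ one_pos).ne'
      measure_closedBall_lt_top.ne
  -- The bound by 1 allows replacing `c₀ ^ n` by `c₀`; the other bound then gives the exponent `1 /
  -- (4 * n)`.
  set c₀ : ℝ := min 1 (1 / (4 * n * v)) with hc₀
  have hc0 : 0 < c₀ := by positivity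
  have hκ : c₀ ^ n * v ≤ 1 / (4 * n) := by
    calc c₀ ^ n * v ≤ c₀ * v := by
          gcongr
          exact pow_le_of_le_one hc0.le (min_le_left _ _) (by omega)
      _ ≤ 1 / (4 * n * v) * v := by
          gcongr
          exact min_le_right _ _
      _ = _ := by field_simp
  -- This normalisation makes the hitting radius `b * M * (2 * n + 3)` equal to `c₀` times the
  -- scale.
  refine ⟨c₀ / (M * (2 * n + 3)), by positivity, fun Ω _ μ _ Y S hmodel => ?_⟩
  have hlim := tendsto_one_sub_exp_pow hn (by positivity) hκ
  have hlim' := ENNReal.tendsto_ofReal hlim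
  rw [ENNReal.ofReal_zero] at hlim'
  refine tendsto_of_tendsto_of_tendsto_of_le_of_le' tendsto_const_nhds hlim'
    (Eventually.of_forall fun _ => zero_le) ?_
  have hscale := (tendsto_coverageScale_mul_rpow hn).const_mul (2 * c₀)
  rw [mul_zero] at hscale
  have hsmall := (tendsto_coverageScale hn).const_mul (c₀ / (2 * n + 3))
  rw [mul_zero] at hsmall
  filter_upwards [eventually_gt_atTop 1, hscale.eventually_lt_const one_pos,
    hsmall.eventually_le_const (show (0 : ℝ) < 1 / 2 by norm_num)] with ρ hρ hsep hsm
  have ha := coverageScale_pos (n := n) hρ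
  have hρ0 : 0 < ρ := by linarith
  have hD : c₀ / (M * (2 * n + 3)) * coverageScale n ρ * M * (2 * n + 3) =
      c₀ * coverageScale n ρ := by field_simp
  have hbM : c₀ / (M * (2 * n + 3)) * coverageScale n ρ * M ≤ 1 / 2 := by
    refine le_trans (le_of_eq ?_) hsm
    field_simp
  have hpow1 : 1 ≤ ρ ^ (1 / (2 * n) : ℝ) := Real.one_le_rpow hρ.le (by positivity)
  have hm : (0 : ℝ) < ⌊ρ ^ (1 / (2 * n) : ℝ)⌋₊ := by
    exact_mod_cast Nat.floor_pos.2 hpow1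
  have hmle : (⌊ρ ^ (1 / (2 * n) : ℝ)⌋₊ : ℝ) ≤ ρ ^ (1 / (2 * n) : ℝ) :=
    Nat.floor_le (by positivity)
  have key := (hmodel ρ hρ0).measure_coverageRadius_lt_le hn hρ0.le (K := K) hM0.le
    (b := c₀ / (M * (2 * n + 3)) * coverageScale n ρ) (by positivity) hM hbM
    (m := ⌊ρ ^ (1 / (2 * n) : ℝ)⌋₊) (by
      rw [hD, lt_div_iff₀ hm]
      refine lt_of_le_of_lt ?_ hsep
      calc 2 * (c₀ * coverageScale n ρ) * (⌊ρ ^ (1 / (2 * n) : ℝ)⌋₊ : ℝ)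
          ≤ 2 * (c₀ * coverageScale n ρ) * ρ ^ (1 / (2 * n) : ℝ) := by gcongr
        _ = _ := by ring)
  refine key.trans (le_of_eq ?_)
  rw [hD, mul_pow, coverageScale_pow hn hρ]
  have : ρ * (c₀ ^ n * (Real.log ρ / ρ) * v) = c₀ ^ n * v * Real.log ρ := by field_simp
  rw [← hv, this]

/-- With high probability the coverage radius is at most of the order `(log ρ / ρ) ^ (1 / n)`. -/
theorem exists_tendsto_measure_lt_coverageRadius.{u} {n : ℕ} (hn : 1 ≤ n) {K : Set (E (n + 1))}
    (hball : ∃ r : ℝ, 0 < r ∧ flatBall n r ⊆ K) (Q : Measure (E (n + 1)))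
    [IsProbabilityMeasure Q] (hcond : DirectionCondition Q) :
    ∃ c : ℝ, 0 < c ∧ ∀ (Ω : Type u) [MeasurableSpace Ω] (μ : Measure Ω) [IsProbabilityMeasure μ]
      (Y : ℝ → ℕ → Ω → E n) (S : ℝ → ℕ → Ω → E (n + 1)),
      (∀ ρ : ℝ, 0 < ρ → IsLineModel μ Q ρ (Y ρ) (S ρ)) →
      Tendsto (fun ρ : ℝ => μ {ω | ENNReal.ofReal (c * coverageScale n ρ) <
        coverageRadius (fun i => Y ρ i ω) (fun i => S ρ i ω) K}) atTop (𝓝 0) := by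
  obtain ⟨r₀, hr₀, hK⟩ := hball
  obtain ⟨p, hp, hpQ⟩ := hcond
  have hn0 : (0 : ℝ) < n := by exact_mod_cast hn
  -- Being at least 1 gives `c₃ ≤ c₃ ^ n`; the other term makes the decay exponent `c₃ ^ n * p` at
  -- least `2 * n + 3`.
  set c₃ : ℝ := max 1 ((2 * n + 3) / p) with hc₃
  have hc1 : 1 ≤ c₃ := le_max_left _ _
  have hc0 : 0 < c₃ := by linarith
  have hκ : 2 * n + 3 ≤ c₃ ^ n * p := by
    calc (2 * n + 3 : ℝ) = (2 * n + 3) / p * p := by field_simp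
      _ ≤ c₃ * p := by
          gcongr
          exact le_max_right _ _
      _ ≤ c₃ ^ n * p := by
          gcongr
          exact le_self_pow₀ hc1 (by omega)
  -- Chosen so that `r * r₀ / 2 = n * ε` with `ε` equal to `c₃` times the scale.
  refine ⟨2 * n * c₃ / r₀, by positivity, fun Ω _ μ _ Y S hmodel => ?_⟩
  have hlim' := ENNReal.tendsto_ofReal (tendsto_grid_mul_exp hκ)
  rw [ENNReal.ofReal_zero] at hlim'
  refine tendsto_of_tendsto_of_tendsto_of_le_of_le' tendsto_const_nhds hlim'
    (Eventually.of_forall fun _ => zero_le) ?_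
  have hsmall := (tendsto_coverageScale hn).const_mul c₃
  rw [mul_zero] at hsmall
  filter_upwards [eventually_ge_atTop (Real.exp 1), eventually_ge_atTop 2,
    hsmall.eventually_le_const (show (0 : ℝ) < 1 / 2 by norm_num)] with ρ hρe hρ2 hsm
  have hρ1 : 1 < ρ := by linarith
  have hρ0 : 0 < ρ := by linarith
  have ha := coverageScale_pos (n := n) hρ1
  have hr : 2 * n * c₃ / r₀ * coverageScale n ρ * r₀ = 2 * n * (c₃ * coverageScale n ρ) := by
    field_simp
  have hmesh : (n : ℝ) / ⌈ρ ^ 2⌉₊ ≤ 2 * n * c₃ / r₀ * coverageScale n ρ * r₀ / 4 := by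
    have h1 : (1 : ℝ) / ⌈ρ ^ 2⌉₊ ≤ 1 / 2 * (1 / ρ) := by
      calc (1 : ℝ) / ⌈ρ ^ 2⌉₊ ≤ 1 / ρ ^ 2 :=
            one_div_le_one_div_of_le (by positivity) (Nat.le_ceil _)
        _ ≤ 1 / (2 * ρ) := one_div_le_one_div_of_le (by positivity) (by nlinarith)
        _ = _ := by field_simp
    have h2 : (1 : ℝ) / ⌈ρ ^ 2⌉₊ ≤ 1 / 2 * (c₃ * coverageScale n ρ) := by
      have h3 := inv_le_coverageScale hn hρe
      nlinarith
    rw [hr]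
    calc (n : ℝ) / ⌈ρ ^ 2⌉₊ = n * (1 / ⌈ρ ^ 2⌉₊) := by ring
      _ ≤ n * (1 / 2 * (c₃ * coverageScale n ρ)) := by gcongr
      _ = _ := by ring
  have key := (hmodel ρ hρ0).measure_lt_coverageRadius_le hn hρ0.le hK
    (r := 2 * n * c₃ / r₀ * coverageScale n ρ) (by positivity) hp.le
    (fun z hz => (hpQ z hz).le) (ε := c₃ * coverageScale n ρ) (by positivity) hsm
    (le_of_eq (by rw [hr]; ring)) (N := ⌈ρ ^ 2⌉₊) (Nat.ceil_pos.2 (by positivity)) hmesh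
  refine key.trans (le_of_eq ?_)
  rw [mul_pow, coverageScale_pow hn hρ1]
  have : ρ * (c₃ ^ n * (Real.log ρ / ρ) * p) = c₃ ^ n * p * Real.log ρ := by field_simp
  rw [this]

/-- Only subadditivity of the outer measure is needed, so `G i` may be non-measurable. -/
lemma tendsto_measure_one_of_tendsto_measure_compl {Ω ι : Type*} [MeasurableSpace Ω]
    {μ : Measure Ω} [IsProbabilityMeasure μ] {l : Filter ι} {G : ι → Set Ω}
    (h : Tendsto (fun i => μ (G i)ᶜ) l (𝓝 0)) : Tendsto (fun i => μ (G i)) l (𝓝 1) := by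
  have h1 : Tendsto (fun i => 1 - μ (G i)ᶜ) l (𝓝 1) := by
    simpa using ENNReal.Tendsto.sub tendsto_const_nhds h (Or.inl ENNReal.one_ne_top)
  refine tendsto_of_tendsto_of_tendsto_of_le_of_le h1 tendsto_const_nhds (fun i => ?_)
    (fun i => prob_le_one)
  rw [tsub_le_iff_right, ← measure_univ (μ := μ), ← union_compl_self (G i)]
  exact measure_union_le _ _

end CylinderCoverage

theorem theorem2 (n : ℕ) (hn : 2 ≤ n + 1)
    (K : Set (CylinderCoverage.E (n + 1))) (hK : Bornology.IsBounded K)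
    (hball : ∃ r : ℝ, 0 < r ∧ CylinderCoverage.flatBall n r ⊆ K)
    (Q : Measure (CylinderCoverage.E (n + 1))) [IsProbabilityMeasure Q]
    (hQ : ∀ᵐ s ∂Q, s ∈ CylinderCoverage.hemisphere n)
    (hcond : CylinderCoverage.DirectionCondition Q) :
    ∃ c₁ c₂ : ℝ, 0 < c₁ ∧ 0 < c₂ ∧
      ∀ (Ω : Type*) [MeasurableSpace Ω] (μ : Measure Ω) [IsProbabilityMeasure μ]
        (Y : ℝ → ℕ → Ω → CylinderCoverage.E n) (S : ℝ → ℕ → Ω → CylinderCoverage.E (n + 1)),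
        (∀ ρ : ℝ, 0 < ρ → CylinderCoverage.IsLineModel μ Q ρ (Y ρ) (S ρ)) →
        -- probability of the event tends to one
        Tendsto (fun ρ : ℝ => μ {ω |
            ENNReal.ofReal c₁ ≤
              CylinderCoverage.coverageRadius (fun i => Y ρ i ω) (fun i => S ρ i ω) K /
                ENNReal.ofReal ((Real.log ρ / ρ) ^ (1 / (n : ℝ))) ∧
            CylinderCoverage.coverageRadius (fun i => Y ρ i ω) (fun i => S ρ i ω) K /
                ENNReal.ofReal ((Real.log ρ / ρ) ^ (1 / (n : ℝ))) ≤ ENNReal.ofReal c₂})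
          atTop (𝓝 1) ∧
        -- the complement has (outer) probability tending to zero: the event need not be
        -- measurable for an arbitrary bounded set `K`
        Tendsto (fun ρ : ℝ => μ {ω | ¬
            (ENNReal.ofReal c₁ ≤
              CylinderCoverage.coverageRadius (fun i => Y ρ i ω) (fun i => S ρ i ω) K /
                ENNReal.ofReal ((Real.log ρ / ρ) ^ (1 / (n : ℝ))) ∧
            CylinderCoverage.coverageRadius (fun i => Y ρ i ω) (fun i => S ρ i ω) K /
                ENNReal.ofReal ((Real.log ρ / ρ) ^ (1 / (n : ℝ))) ≤ ENNReal.ofReal c₂)})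
          atTop (𝓝 0) := by
  have hn1 : 1 ≤ n := by omega
  obtain ⟨c₁, hc₁, hlow⟩ := CylinderCoverage.exists_tendsto_measure_coverageRadius_lt hn1 hK Q
  obtain ⟨c₂, hc₂, hup⟩ :=
    CylinderCoverage.exists_tendsto_measure_lt_coverageRadius hn1 hball Q hcond
  refine ⟨c₁, c₂, hc₁, hc₂, fun Ω _ μ _ Y S hmodel => ?_⟩
  refine (fun h => ⟨CylinderCoverage.tendsto_measure_one_of_tendsto_measure_compl h, h⟩) ?_
  have hsum := (hlow Ω μ Y S hmodel).add (hup Ω μ Y S hmodel)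
  rw [add_zero] at hsum
  refine tendsto_of_tendsto_of_tendsto_of_le_of_le' tendsto_const_nhds hsum
    (Eventually.of_forall fun _ => zero_le) ?_
  -- For `ρ > 1` the scale is positive and finite, so the divisions clear and the bad event splits
  -- into the two one-sided events.
  filter_upwards [eventually_gt_atTop 1] with ρ hρ
  refine (measure_mono fun ω hω => ?_).trans (measure_union_le _ _)
  have ha : 0 < CylinderCoverage.coverageScale n ρ := CylinderCoverage.coverageScale_pos hρ
  have ha0 : ENNReal.ofReal (CylinderCoverage.coverageScale n ρ) ≠ 0 :=
    (ENNReal.ofReal_pos.2 ha).ne'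
  have hω' : ¬ (ENNReal.ofReal c₁ ≤ _ / ENNReal.ofReal (CylinderCoverage.coverageScale n ρ) ∧
    _ / ENNReal.ofReal (CylinderCoverage.coverageScale n ρ) ≤ ENNReal.ofReal c₂) := hω
  rw [ENNReal.le_div_iff_mul_le (Or.inl ha0) (Or.inl ENNReal.ofReal_ne_top),
    ENNReal.div_le_iff ha0 ENNReal.ofReal_ne_top, ← ENNReal.ofReal_mul hc₁.le,
    ← ENNReal.ofReal_mul hc₂.le, not_and_or, not_le, not_le] at hω'
  exact hω'
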